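/- **Theorem (finite $(\gamma,k)$-fat-shattering dimension is sufficient).** Let $\mathcal X$ be a measurable space, $k\ge 1$ an integer and $\mathcal H\subseteq[0,1]^{\mathcal X}$ a nonempty class. For $\gamma\in(0,1)$, $\mathcal H$ *$(\gamma,k)$-fat-shatters* $(x_1,\dots,x_d)\in\mathcal X^d$ if there are $c_1,\dots,c_d\in[0,1]^k$ with $c_{i,j+1}\ge c_{i,j}+2\gamma$ for all $i$ and all $1\le j<k$, such that for every $b\in\{0,\dots,k\}^d$ some $h_b\in\mathcal H$ satisfies, for every $i$: $h_b(x_i)\le c_{i,1}-\gamma$ if $b_i=0$; $c_{i,b_i}+\gamma\le h_b(x_i)\le c_{i,b_i+1}-\gamma$ if $0<b_i<k$; $c_{i,k}+\gamma\le h_b(x_i)$ if $b_i=k$. Let $\mathbb D^{\mathrm{fat}}_{\gamma,k}(\mathcal H)\in\{0,1,\dots,\infty\}$ be the supremum of the lengths of $(\gamma,k)$-fat-shattered sequences. For a distribution $\mathcal D$ on $\mathcal X\times[0,1]$ and $\mu:\mathcal X\to[0,1]^k$ put $\mathrm{err}_{\mathcal D}(\mu)=\mathbb E_{(x,y)\sim\mathcal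 D}\min_{j\le k}|\mu(x)_j-y|$, and $\mathrm{err}_{\mathcal D}(h)=\mathbb E_{(x,y)\sim\mathcal D}|h(x)-y|$ for $h:\mathcal X\to[0,1]$. A *$k$-list learner* $\mathcal A$ maps every finite sample $S$ in $\mathcal X\times[0,1]$ to a function $\mathcal A(S):\mathcal X\to[0,1]^k$. Distributions $\mathcal D$ are understood to be such that $\mathcal H$ is measurable with respect to them: each $h\in\mathcal H$, and for each $m$ the set-valued map $(x_1,\dots,x_m)\mapsto\{(h(x_1),\dots,h(x_m)):h\in\mathcal H\}$, is (weakly) measurable up to null sets of the marginal of $\mathcal D$ on $\mathcal X$, respectively of its $m$-fold product. There are universal constants $C\ge1$ and $p\in\mathbb N$ such that, for all $\mathcal X$, $\mathcal H$ and $k$ as above, the following hold. 1. For every $\gamma\in(0,1)$ with $\mathbb D^{\mathrm{fat}}_{\gamma/2,k}(\mathcal H)<\infty$ there is a $k$-list learner $\mathcal A$ such that for every distribution $\mathcal D$ on $\mathcal X\times[0,1]$, every $n\ge1$ and every $\delta\in(0,1)$, with probability at least $1-\delta$ over $S\sim\mathcal D^n$, $$\mathrm{err}_{\mathcal D}(\mathcal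 A(S))\le\inf_{h\in\mathcal H}\mathrm{err}_{\mathcal D}(h)+C\,k\,\gamma+C\sqrt{\frac{k^8\,\mathbb D^{\mathrm{fat}}_{\gamma/2,k}(\mathcal H)+\log(1/\delta)}{n}}\;\Bigl(1+\log\frac{nk}{\gamma}\Bigr)^{p}.$$ 2. There is a $k$-list learner $\mathcal A$ such that for all $\varepsilon,\delta\in(0,1)$ for which, with $\gamma=\frac{\varepsilon}{Ck}$, $\mathbb D^{\mathrm{fat}}_{\gamma/2,k}(\mathcal H)<\infty$, its agnostic sample complexity satisfies $$m_{\mathcal A,\mathcal H}(\varepsilon,\delta)\le\Bigl\lceil C\,G\,\Bigl(1+\log\frac{(1+G)k}{\varepsilon}\Bigr)^{p}\Bigr\rceil,\qquad G=\frac{k^8\,\mathbb D^{\mathrm{fat}}_{\gamma/2,k}(\mathcal H)+\log(1/\delta)}{\varepsilon^2},$$ where $m_{\mathcal A,\mathcal H}(\varepsilon,\delta)$ is the least $m$ such that for every $n\ge m$ and every $\mathcal D$, with probability at least $1-\delta$ over $S\sim\mathcal D^n$, $\mathrm{err}_{\mathcal D}(\mathcal A(S))\le\inf_{h\in\mathcal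 H}\mathrm{err}_{\mathcal D}(h)+\varepsilon$. -/

import Mathlib

open MeasureTheory
open scoped unitInterval ENNReal

noncomputable section

namespace ListRegression

/-- `H` `(γ, k)`-fat-shatters the sequence `x`: there are anchors
`c i 0, …, c i (k - 1)` in `[0,1]`, consecutive ones at distance at least `2γ`, such that each
pattern `b ∈ {0, …, k}^d` is realized by some `h ∈ H` with
`c i (b i - 1) + γ ≤ h (x i) ≤ c i (b i) - γ`, where the left inequality is dropped
if `b i = 0` and the right one if `b i = k`. -/
def FatShatters {X : Type*} (H : Set (X → I)) (γ : ℝ) (k : ℕ) {d : ℕ} (x : Fin d → X) : Prop :=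
  ∃ c : Fin d → Fin k → I,
    (∀ i, ∀ j j' : Fin k, (j' : ℕ) = j + 1 → (c i j : ℝ) + 2 * γ ≤ c i j') ∧
    ∀ b : Fin d → Fin (k + 1), ∃ h ∈ H, ∀ i, ∀ j : Fin k,
      ((b i : ℕ) = j + 1 → (c i j : ℝ) + γ ≤ h (x i)) ∧
      ((b i : ℕ) = j → (h (x i) : ℝ) ≤ c i j - γ)

/-- The `(γ, k)`-fat-shattering dimension, `⊤` if arbitrarily long sequences are shattered. -/
def fatDim {X : Type*} (H : Set (X → I)) (γ : ℝ) (k : ℕ) : ℕ∞ :=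
  ⨆ (d : ℕ) (_ : ∃ x : Fin d → X, FatShatters H γ k x), (d : ℕ∞)

/-- The absolute loss of a `k`-list `μ` against the label `y`: `min_j |μ_j - y|`. -/
def listLoss {k : ℕ} (μ : Fin k → I) (y : I) : ℝ := ⨅ j, |(μ j : ℝ) - y|

/-- The expected absolute loss of a `k`-list hypothesis. -/
def listErr {X : Type*} [MeasurableSpace X] {k : ℕ} (D : Measure (X × I))
    (μ : X → Fin k → I) : ℝ :=
  ∫ z, listLoss (μ z.1) z.2 ∂D

/-- The expected absolute loss of a hypothesis, seen as a list hypothesis with lists of size 1. -/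
def hypErr {X : Type*} [MeasurableSpace X] (D : Measure (X × I)) (h : X → I) : ℝ :=
  listErr D (fun x (_ : Fin 1) => h x)

/-- A `k`-list learning algorithm maps a labelled sample of any size to a `k`-list hypothesis. -/
abbrev ListLearner (X : Type*) (k : ℕ) : Type _ :=
  ∀ n : ℕ, (Fin n → X × I) → X → Fin k → I

/-- The measurability convention on `H` with respect to the distribution `D`, whose marginal on
`X` is `D.fst`: every hypothesis is measurable up to null sets, and so is, for every `m`, the
set-valued map `x ↦ H|_x = {(h (x 1), …, h (x m)) : h ∈ H}` (weak measurability: the points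
whose value meets a given open set form a measurable set up to null sets). -/
def IsMeasurableClass {X : Type*} [MeasurableSpace X] (H : Set (X → I))
    (D : Measure (X × I)) : Prop :=
  (∀ h ∈ H, AEMeasurable h D.fst) ∧
  ∀ (m : ℕ) (U : Set (Fin m → I)), IsOpen U →
    NullMeasurableSet {x : Fin m → X | ∃ h ∈ H, (fun i => h (x i)) ∈ U}
      (Measure.pi fun _ => D.fst)

/-- With probability at least `1 - δ` over an i.i.d. sample `S ∼ D^n`, the output of `A` on `S`
is measurable up to a null set and its error is at most `inf_{h ∈ H} err_D(h) + r`.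
The failure event is bounded in outer measure, so no measurability of it is presupposed. -/
def AgnosticBound {X : Type*} [MeasurableSpace X] {k : ℕ} (H : Set (X → I))
    (A : ListLearner X k) (D : Measure (X × I)) (n : ℕ) (r δ : ℝ) : Prop :=
  (Measure.pi fun _ : Fin n => D)
    {S | ¬ (AEMeasurable (A n S) D.fst ∧
      listErr D (A n S) ≤ (⨅ h : H, hypErr D h.1) + r)} ≤ ENNReal.ofReal δ

/-- The agnostic sample complexity of the learner `A` for the class `H`: the least `m` such that
`n ≥ m` examples always suffice for excess error `ε` with probability `1 - δ`, whatever the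
distribution (`⊤` if there is no such `m`). -/
def sampleComplexity {X : Type*} [MeasurableSpace X] {k : ℕ} (H : Set (X → I))
    (A : ListLearner X k) (ε δ : ℝ) : ℕ∞ :=
  ⨅ (m : ℕ) (_ : ∀ n : ℕ, m ≤ n → ∀ D : Measure (X × I), IsProbabilityMeasure D →
    IsMeasurableClass H D → AgnosticBound H A D n ε δ), (m : ℕ∞)

/-- The numerator `k^8 · D + log (1/δ)`, where `D` is the `(γ/2, k)`-fat-shattering dimension
of `H` (used only when that dimension is finite). -/
def complexity {X : Type*} (H : Set (X → I)) (k : ℕ) (γ δ : ℝ) : ℝ :=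
  (k : ℝ) ^ 8 * ((fatDim H (γ / 2) k).toNat : ℝ) + Real.log (1 / δ)

end ListRegression

end

/-! At a fixed scale γ the learner is a sample compression scheme. Values are rounded to a grid of
step γ. A grid chain with gaps at least 3 leaves room for fat-shattering anchors of margin γ/2, so
the rounded class shatters chains of k + 1 values on at most d coordinates, d being the dimension at
γ/2 (`card_support_le`). A Sauer-type count and a recursion on heavy values (`sum_shatCount_le`,
`listCover_of_shatCount`) then cover all rounded patterns on N points by few functions with lists of
size k.

Such covers give a transductive weak learner. Among N points drawn from any distribution on the
sample, a uniformly random subset A eliminates the cover members with many errors, and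
exchangeability turns few errors over all positions into a small expected error at one fresh
position (`exists_weakList`). Multiplicative weights combine T weak lists so that fewer than T/(k+1)
of them miss any given sample point. The values hit by more than a fraction k/(k+1) of the lists
again have a net of k points (`exists_net`, `hits_combine`). Hence every h in `H` is within 5γ, on
the whole sample, of a list hypothesis described by at most TN sample indices and finite data
(`exists_recon_near`).

The rounded labels in a description are those of h, not those of the sample, so the agnostic case
needs no reduction to the realizable one: the empirical loss is minimized over all descriptions.
Each description generalizes by Hoeffding's inequality on the points it does not use, and a union
bound over descriptions finishes (`exists_erm`). With T of order kΛ and N of order k³dΛ², Λ the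
logarithmic factor, this is the stated rate.

Two points need a separate argument. If d = 0 the bound leaves no room for the cost of compression,
but then the values of `H` at each point contain no long chain and one list hypothesis, independent
of the sample, approximates all of `H`. If ε is unknown, the learner for sample size n aims at
nearly the best accuracy that n allows, which depends only on `H`, k and n. When that accuracy can
be arbitrarily small, every dimension vanishes and the sample-independent list has no excess error.
-/

noncomputable section

namespace ListRegression

/-! ### Spaced chains and nets -/

/-- All gaps of the increasing chain `v` are at least `s`. -/
def Spaced (s : ℕ) {m L : ℕ} (v : Fin m → Fin L) : Prop :=
  ∀ i j, i < j → (v i : ℕ) + s ≤ v j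

/-- Some element of the list `ℓ` is at distance less than `s` from `v`. -/
def Hits (s : ℕ) {L : ℕ} (ℓ : Finset (Fin L)) (v : Fin L) : Prop :=
  ∃ a ∈ ℓ, (a : ℕ) < v + s ∧ (v : ℕ) < a + s

/-- Greedy choice: take the least element of `V` and recurse on the elements at least `s` above it;
each chosen point would extend a spaced chain downwards. -/
theorem exists_net {s L : ℕ} (k : ℕ) (V : Set (Fin L))
    (hV : ∀ v : Fin (k + 1) → Fin L, Spaced s v → ¬ ∀ j, v j ∈ V) :
    ∃ ℓ : Finset (Fin L), ℓ.card ≤ k ∧ ∀ v ∈ V, Hits s ℓ v := by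
  classical
  induction k generalizing V with
  | zero =>
    refine ⟨∅, by simp, fun v hv => ?_⟩
    exact (hV (fun _ => v) (fun i j hij => absurd hij (by omega)) (fun _ => hv)).elim
  | succ k ih =>
    rcases V.eq_empty_or_nonempty with rfl | hne
    · exact ⟨∅, by simp, by simp⟩
    obtain ⟨v0, hv0, hmin⟩ := Set.exists_min_image V id (Set.toFinite V) hne
    obtain ⟨ℓ, hℓ, hcov⟩ := ih {v | v ∈ V ∧ (v0 : ℕ) + s ≤ v} (by
      intro v hv hall
      refine hV (Fin.cons v0 v) ?_ ?_
      · intro i j hij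
        induction i using Fin.cases with
        | zero =>
          induction j using Fin.cases with
          | zero => exact absurd hij (by simp)
          | succ j => simpa using (hall j).2
        | succ i =>
          induction j using Fin.cases with
          | zero => exact absurd hij (by simp)
          | succ j => simpa using hv i j (by simpa using hij)
      · intro j
        induction j using Fin.cases with
        | zero => simpa using hv0
        | succ j => simpa using (hall j).1)
    refine ⟨insert v0 ℓ, (Finset.card_insert_le _ _).trans (by omega), fun v hv => ?_⟩
    have h0 : (v0 : ℕ) ≤ v := hmin v hv
    by_cases h : (v0 : ℕ) + s ≤ v
    · obtain ⟨a, ha, h1⟩ := hcov v ⟨hv, h⟩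
      exact ⟨a, Finset.mem_insert_of_mem ha, h1⟩
    · exact ⟨v0, Finset.mem_insert_self _ _, by omega, by omega⟩

/-! ### Shattered chains and list covers of rounded patterns -/

section Cover

variable {ι : Type*} {L k : ℕ}

/-- `F` realizes every choice of values along the chains attached by `w` to some coordinates. -/
def Shat (F : Set (ι → Fin L)) (w : ι → Option (Fin (k + 1) → Fin L)) : Prop :=
  (∀ i c, w i = some c → Spaced 3 c) ∧
    ∀ b : ι → Fin (k + 1), ∃ p ∈ F, ∀ i c, w i = some c → p i = c (b i)

/-- `F` is covered by at most `B` functions with values in lists of size `k`. -/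
def ListCover (k : ℕ) (F : Set (ι → Fin L)) (B : ℕ) : Prop :=
  ∃ G : Finset (ι → Finset (Fin L)), G.card ≤ B ∧ (∀ g ∈ G, ∀ i, (g i).card ≤ k) ∧
    ∀ p ∈ F, ∃ g ∈ G, ∀ i, Hits 3 (g i) (p i)

theorem Shat.mono {F F' : Set (ι → Fin L)} (h : F ⊆ F')
    {w : ι → Option (Fin (k + 1) → Fin L)} (hw : Shat F w) : Shat F' w :=
  ⟨hw.1, fun b => let ⟨p, hp, h'⟩ := hw.2 b; ⟨p, h hp, h'⟩⟩

/-- A chain attached at `i` would force both its first and its last element to equal `a`, although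
they are spaced. -/
theorem Shat.eq_none (hk : 1 ≤ k) {F : Set (ι → Fin L)} {i : ι} {a : Fin L}
    {w : ι → Option (Fin (k + 1) → Fin L)} (hw : Shat {p ∈ F | p i = a} w) : w i = none := by
  by_contra hne
  obtain ⟨c, hc⟩ := Option.ne_none_iff_exists'.1 hne
  obtain ⟨p, hp, hpc⟩ := hw.2 (fun _ => 0)
  obtain ⟨q, hq, hqc⟩ := hw.2 (fun _ => Fin.last k)
  have h1 := hpc i c hc
  have h2 := hqc i c hc
  have h3 := hw.1 i c hc 0 (Fin.last k) (by
    rw [Fin.lt_def, Fin.val_last, Fin.val_zero]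
    exact hk)
  have : c 0 = c (Fin.last k) := by rw [← h1, ← h2, hp.2, hq.2]
  rw [this] at h3
  omega

variable [DecidableEq ι]

theorem Shat.update {F : Set (ι → Fin L)} {i : ι} {c : Fin (k + 1) → Fin L} (hc : Spaced 3 c)
    {w : ι → Option (Fin (k + 1) → Fin L)} (hi : w i = none)
    (hw : ∀ j, Shat {p ∈ F | p i = c j} w) : Shat F (Function.update w i (some c)) := by
  refine ⟨fun i' c' h => ?_, fun b => ?_⟩
  · by_cases hii : i' = i
    · subst hii
      simp only [Function.update_self, Option.some.injEq] at h
      exact h ▸ hc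
    · rw [Function.update_of_ne hii] at h
      exact (hw 0).1 i' c' h
  · obtain ⟨p, hp, hpw⟩ := (hw (b i)).2 b
    refine ⟨p, hp.1, fun i' c' h => ?_⟩
    by_cases hii : i' = i
    · subst hii
      simp only [Function.update_self, Option.some.injEq] at h
      rw [hp.2, h]
    · rw [Function.update_of_ne hii] at h
      exact hpw i' c' h

variable [Fintype ι]

open scoped Classical in
/-- The number of systems of chains shattered by `F`. -/
def shatCount (k : ℕ) (F : Set (ι → Fin L)) : ℕ :=
  (Finset.univ.filter fun w : ι → Option (Fin (k + 1) → Fin L) => Shat F w).card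

/-- The analogue of the Sauer–Shelah step. A system is shattered by all k + 1 branches (set `Q`) or
by at most k of those counted in `P`. None of them uses coordinate `i`, so attaching `c` there sends
`Q` injectively to further systems shattered by `F`. The sum is thus at most k|P| + |Q| ≤ k(|P| +
|Q|). -/
theorem sum_shatCount_le (hk : 1 ≤ k) (F : Set (ι → Fin L)) (i : ι) {c : Fin (k + 1) → Fin L}
    (hc : Spaced 3 c) :
    ∑ j, shatCount k {p ∈ F | p i = c j} ≤ k * shatCount k F := by
  classical
  set W := ι → Option (Fin (k + 1) → Fin L)
  set P : Finset W := Finset.univ.filter fun w => ∃ j, Shat {p ∈ F | p i = c j} w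
  set Q : Finset W := Finset.univ.filter fun w => ∀ j, Shat {p ∈ F | p i = c j} w
  have hQP : Q ⊆ P := by
    intro w hw
    simp only [Q, P, Finset.mem_filter, Finset.mem_univ, true_and] at hw ⊢
    exact ⟨0, hw 0⟩
  have hPn : ∀ w ∈ P, w i = none := by
    intro w hw
    simp only [P, Finset.mem_filter, Finset.mem_univ, true_and] at hw
    obtain ⟨j, hj⟩ := hw
    exact hj.eq_none hk
  have h1 : ∑ j, shatCount k {p ∈ F | p i = c j} ≤ k * P.card + Q.card := by
    have : ∑ j, shatCount k {p ∈ F | p i = c j}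
        = ∑ w : W, (Finset.univ.filter fun j => Shat {p ∈ F | p i = c j} w).card := by
      simp only [shatCount, Finset.card_filter]
      rw [Finset.sum_comm]
    rw [this]
    have h2 : ∀ w : W, (Finset.univ.filter fun j => Shat {p ∈ F | p i = c j} w).card
        ≤ (if w ∈ P then k else 0) + (if w ∈ Q then 1 else 0) := by
      intro w
      by_cases hQ : w ∈ Q
      · rw [if_pos (hQP hQ), if_pos hQ]
        exact (Finset.card_le_univ _).trans (by simp)
      · rw [if_neg hQ]
        by_cases hP : w ∈ P
        · rw [if_pos hP]
          have : (Finset.univ.filter fun j => Shat {p ∈ F | p i = c j} w)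
              ⊂ (Finset.univ : Finset (Fin (k + 1))) := by
            rw [Finset.ssubset_univ_iff]
            intro hu
            apply hQ
            simp only [Q, Finset.mem_filter, Finset.mem_univ, true_and]
            intro j
            have := Finset.mem_univ j
            rw [← hu] at this
            simpa using this
          have := Finset.card_lt_card this
          simp only [Finset.card_univ, Fintype.card_fin] at this
          omega
        · rw [if_neg hP]
          simp only [P, Finset.mem_filter, Finset.mem_univ, true_and, not_exists] at hP
          simp [hP]
    refine (Finset.sum_le_sum fun w _ => h2 w).trans ?_
    rw [Finset.sum_add_distrib]
    simp [Finset.sum_ite_mem, mul_comm]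
  have h3 : P.card + Q.card ≤ shatCount k F := by
    have hinj : Set.InjOn (fun w : W => Function.update w i (some c)) (Q : Set W) := by
      intro w hw w' hw' h
      have e1 := hPn w (hQP hw)
      have e2 := hPn w' (hQP hw')
      funext x
      by_cases hx : x = i
      · rw [hx, e1, e2]
      · have := congrFun h x
        simpa [Function.update_of_ne hx] using this
    rw [← Finset.card_image_of_injOn hinj, ← Finset.card_union_of_disjoint]
    · apply Finset.card_le_card
      intro w hw
      rw [Finset.mem_union, Finset.mem_image] at hw
      simp only [Finset.mem_filter, Finset.mem_univ, true_and]
      rcases hw with hw | ⟨w, hw, rfl⟩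
      · simp only [P, Finset.mem_filter, Finset.mem_univ, true_and] at hw
        obtain ⟨j, hj⟩ := hw
        exact hj.mono (Set.sep_subset _ _)
      · have e := hPn w (hQP hw)
        simp only [Q, Finset.mem_filter, Finset.mem_univ, true_and] at hw
        exact Shat.update hc e hw
    · rw [Finset.disjoint_left]
      intro w hw hw'
      rw [Finset.mem_image] at hw'
      obtain ⟨w', -, rfl⟩ := hw'
      have := hPn _ hw
      simp at this
  have : Q.card ≤ k * Q.card := Nat.le_mul_of_pos_left _ hk
  calc _ ≤ k * P.card + Q.card := h1
    _ ≤ k * (P.card + Q.card) := by rw [mul_add]; omega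
    _ ≤ _ := Nat.mul_le_mul_left _ h3

/-- The exponent `r` bounds the depth of the recursion: among k + 1 spaced branches at a coordinate,
one has its count reduced by a factor k/(k+1). -/
theorem listCover_of_shatCount (hk : 1 ≤ k) (r : ℕ) (F : Set (ι → Fin L))
    (h : shatCount k F * k ^ r < (k + 1) ^ r) :
    ListCover k F ((Fintype.card ι * L + 1) ^ r) := by
  classical
  induction r generalizing F with
  | zero =>
    have h0 : shatCount k F = 0 := by simpa using h
    -- The empty system is shattered by every nonempty family, so count zero forces `F` to be empty.
    have hF : F = ∅ := by
      by_contra hne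
      obtain ⟨p, hp⟩ := Set.nonempty_iff_ne_empty.2 hne
      rw [shatCount, Finset.card_eq_zero, Finset.filter_eq_empty_iff] at h0
      exact h0 (Finset.mem_univ fun _ => none)
        ⟨fun i c hc => by simp at hc, fun b => ⟨p, hp, fun i c hc => by simp at hc⟩⟩
    subst hF
    exact ⟨∅, by simp, by simp, by simp⟩
  | succ r ih =>
    set B := (Fintype.card ι * L + 1) ^ r with hB
    -- Heavy values: those whose branch has no cover of size `B`. They contain no spaced chain of
    -- length k + 1, hence have a net of k points.
    let V : ι → Set (Fin L) := fun i => {a | ¬ ListCover k {p ∈ F | p i = a} B}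
    have hV : ∀ i, ∃ ℓ : Finset (Fin L), ℓ.card ≤ k ∧ ∀ v ∈ V i, Hits 3 ℓ v := by
      intro i
      refine exists_net k (V i) fun c hc hall => ?_
      have h1 : ∀ j, (k + 1) ^ r ≤ shatCount k {p ∈ F | p i = c j} * k ^ r := by
        intro j
        by_contra hlt
        exact hall j (ih _ (not_le.1 hlt))
      have h2 := Finset.sum_le_sum fun j (_ : j ∈ (Finset.univ : Finset (Fin (k + 1)))) => h1 j
      rw [← Finset.sum_mul] at h2
      have h3 := h2.trans (Nat.mul_le_mul_right _ (sum_shatCount_le hk F i hc))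
      simp only [Finset.sum_const, Finset.card_univ, Fintype.card_fin, smul_eq_mul] at h3
      rw [pow_succ, pow_succ] at h
      nlinarith
    choose g hg hgV using hV
    have hlight : ∀ x : ι × Fin L, ∃ G : Finset (ι → Finset (Fin L)), G.card ≤ B ∧
        (∀ g ∈ G, ∀ i, (g i).card ≤ k) ∧
        (x.2 ∉ V x.1 → ∀ p ∈ F, p x.1 = x.2 → ∃ g ∈ G, ∀ i, Hits 3 (g i) (p i)) := by
      intro x
      by_cases hx : x.2 ∈ V x.1
      · exact ⟨∅, by simp, by simp, fun h => absurd hx h⟩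
      · obtain ⟨G, h1, h2, h3⟩ := not_not.1 hx
        exact ⟨G, h1, h2, fun _ p hp hpx => h3 p ⟨hp, hpx⟩⟩
    choose G hGB hGk hGc using hlight
    -- Patterns heavy everywhere are covered by the single function `g` made of the nets; any other
    -- pattern is covered through one of its light coordinates.
    refine ⟨insert g (Finset.univ.biUnion G), ?_, ?_, ?_⟩
    · refine (Finset.card_insert_le _ _).trans ?_
      have h1 : (Finset.univ.biUnion G).card ≤ (Fintype.card ι * L) * B := by
        refine Finset.card_biUnion_le.trans ((Finset.sum_le_sum fun x _ => hGB x).trans ?_)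
        simp
      have h2 : 1 ≤ B := Nat.one_le_pow _ _ (by omega)
      rw [pow_succ, ← hB]
      nlinarith
    · intro f hf i
      rw [Finset.mem_insert, Finset.mem_biUnion] at hf
      rcases hf with rfl | ⟨x, -, hx⟩
      · exact hg i
      · exact hGk x f hx i
    · intro p hp
      by_cases hall : ∀ i, p i ∈ V i
      · exact ⟨g, Finset.mem_insert_self _ _, fun i => hgV i _ (hall i)⟩
      · obtain ⟨i, hi⟩ := not_forall.1 hall
        obtain ⟨f, hf, hfc⟩ := hGc (i, p i) hi p hp rfl
        exact ⟨f, Finset.mem_insert_of_mem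
          (Finset.mem_biUnion.2 ⟨_, Finset.mem_univ _, hf⟩), hfc⟩

/-- Partial maps with small support are few. -/
theorem card_small_support_le {α : Type*} [Fintype α] (d : ℕ) (P : Finset (ι → Option α))
    (hP : ∀ w ∈ P, (Finset.univ.filter fun i => w i ≠ none).card ≤ d) :
    P.card ≤ (Fintype.card ι * Fintype.card α + 1) ^ d := by
  classical
  -- A partial map with at most `d` support points is decoded from `d` optional pairs of a
  -- coordinate and a value.
  let Φ : (Fin d → Option (ι × α)) → ι → Option α := fun u i =>
    if h : ∃ a j, u j = some (i, a) then some h.choose else none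
  have hsub : P ⊆ Finset.univ.image Φ := by
    intro w hw
    rw [Finset.mem_image]
    set S := Finset.univ.filter fun i => w i ≠ none
    have hS : S.card ≤ d := hP w hw
    let e := S.equivFin
    refine ⟨fun j => if h : (j : ℕ) < S.card then
      (w (e.symm ⟨j, h⟩)).map fun a => ((e.symm ⟨j, h⟩ : ι), a) else none,
      Finset.mem_univ _, ?_⟩
    have key : ∀ i a, (∃ j : Fin d, (if h : (j : ℕ) < S.card then
      (w (e.symm ⟨j, h⟩)).map fun a => ((e.symm ⟨j, h⟩ : ι), a) else none) = some (i, a)) ↔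
        w i = some a := by
      intro i a
      constructor
      · rintro ⟨j, hj⟩
        split_ifs at hj with h
        rw [Option.map_eq_some_iff] at hj
        obtain ⟨a', h1, h2⟩ := hj
        rw [Prod.mk.injEq] at h2
        rw [← h2.1, ← h2.2, h1]
      · intro h
        have hi : i ∈ S := by simp [S, h]
        refine ⟨⟨e ⟨i, hi⟩, (e ⟨i, hi⟩).2.trans_le hS⟩, ?_⟩
        simp [h]
    funext i
    simp only [Φ]
    split_ifs with h
    · exact ((key i _).1 h.choose_spec).symm
    · cases hwi : w i with
      | none => rfl
      | some a => exact (h ⟨a, (key i a).2 hwi⟩).elim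
  refine (Finset.card_le_card hsub).trans (Finset.card_image_le.trans ?_)
  simp

/-- A family of patterns without large shattered systems of chains has a small list cover. -/
theorem listCover_of_dim (hk : 1 ≤ k) {d r : ℕ} (F : Set (ι → Fin L))
    (hd : ∀ w : ι → Option (Fin (k + 1) → Fin L), Shat F w →
      (Finset.univ.filter fun i => w i ≠ none).card ≤ d)
    (hr : (Fintype.card ι * L ^ (k + 1) + 1) ^ d * k ^ r < (k + 1) ^ r) :
    ListCover k F ((Fintype.card ι * L + 1) ^ r) := by
  classical
  apply listCover_of_shatCount hk
  refine lt_of_le_of_lt (Nat.mul_le_mul_right _ ?_) hr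
  refine (card_small_support_le d _ fun w hw => hd w ?_).trans (by simp)
  simpa using hw

end Cover

/-! ### Transductive weak learning from a list cover -/

section Weak

variable {N L : ℕ}

open scoped Classical in
/-- The list predicted at position `j` by a member of `G` consistent with the labels `b` on `A`. -/
def weakList (G : Finset (Fin N → Finset (Fin L))) (A : Finset (Fin N)) (j : Fin N)
    (b : Fin N → Fin L) : Finset (Fin L) :=
  if h : ∃ g ∈ G, ∀ i ∈ A, Hits 3 (g i) (b i) then h.choose j else ∅

-- Only the labels on `A` enter the choice, so the prediction at a position outside `A` does not use
-- its label.
open scoped Classical in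
theorem weakList_congr (G : Finset (Fin N → Finset (Fin L))) (A : Finset (Fin N)) (j : Fin N)
    {b b' : Fin N → Fin L} (h : ∀ i ∈ A, b i = b' i) :
    weakList G A j b = weakList G A j b' := by
  have : (fun g => g ∈ G ∧ ∀ i ∈ A, Hits 3 (g i) (b i)) =
      fun g => g ∈ G ∧ ∀ i ∈ A, Hits 3 (g i) (b' i) := by
    funext g
    refine propext (and_congr_right fun _ => forall₂_congr fun i hi => ?_)
    rw [h i hi]
  have key : ∀ Q Q' : (Fin N → Finset (Fin L)) → Prop, Q = Q' →
      (if h : ∃ g, Q g then h.choose j else ∅) = if h : ∃ g, Q' g then h.choose j else ∅ := by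
    rintro Q _ rfl
    rfl
  unfold weakList
  convert key _ _ this

theorem card_weakList_le {k : ℕ} {G : Finset (Fin N → Finset (Fin L))}
    (hG : ∀ g ∈ G, ∀ i, (g i).card ≤ k) (A : Finset (Fin N)) (j : Fin N) (b : Fin N → Fin L) :
    (weakList G A j b).card ≤ k := by
  unfold weakList
  split_ifs with h
  · exact hG _ h.choose_spec.1 j
  · simp

-- A cover member with at least `r` errors is consistent with a uniformly random `A` with
-- probability at most 2^(-r). Outside the union of these events the chosen member has fewer than
-- `r` errors; otherwise the number of errors is bounded by `N`.
open scoped Classical in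
theorem count_weakList_errors {B r : ℕ} (G : Finset (Fin N → Finset (Fin L))) (hB : G.card ≤ B)
    (p : Fin N → Fin L) (hcov : ∃ g ∈ G, ∀ i, Hits 3 (g i) (p i)) :
    (∑ A : Finset (Fin N), ∑ j, if Hits 3 (weakList G A j p) (p j) then (0 : ℝ) else 1)
      ≤ 2 ^ N * (r + N * (B / 2 ^ r)) := by
  let E : (Fin N → Finset (Fin L)) → Finset (Fin N) := fun g =>
    Finset.univ.filter fun i => ¬ Hits 3 (g i) (p i)
  set G' := G.filter fun g => r ≤ (E g).card
  have hA : ∀ A : Finset (Fin N),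
      (∑ j, if Hits 3 (weakList G A j p) (p j) then (0 : ℝ) else 1)
        ≤ r + N * ∑ g ∈ G', if Disjoint A (E g) then (1 : ℝ) else 0 := by
    intro A
    have hex : ∃ g ∈ G, ∀ i ∈ A, Hits 3 (g i) (p i) :=
      let ⟨g, hg, h⟩ := hcov; ⟨g, hg, fun i _ => h i⟩
    have hsum : (∑ j, if Hits 3 (weakList G A j p) (p j) then (0 : ℝ) else 1)
        = (E hex.choose).card := by
      simp only [E, Finset.card_filter, weakList, dif_pos hex]
      push_cast
      exact Finset.sum_congr rfl fun j _ => by split_ifs <;> simp_all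
    rw [hsum]
    have hnn : ∀ g ∈ G', (0 : ℝ) ≤ if Disjoint A (E g) then (1 : ℝ) else 0 := by
      intro g _; split_ifs <;> norm_num
    by_cases hr : r ≤ (E hex.choose).card
    · have hmem : hex.choose ∈ G' := Finset.mem_filter.2 ⟨hex.choose_spec.1, hr⟩
      have hdis : Disjoint A (E hex.choose) := by
        rw [Finset.disjoint_left]
        intro i hi hi'
        simp only [E, Finset.mem_filter, Finset.mem_univ, true_and] at hi'
        exact hi' (hex.choose_spec.2 i hi)
      have h1 := Finset.single_le_sum hnn hmem
      rw [if_pos hdis] at h1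
      have h2 : ((E hex.choose).card : ℝ) ≤ N := by
        exact_mod_cast (Finset.card_le_univ _).trans (by simp)
      have : (N : ℝ) * 1 ≤ N * ∑ g ∈ G', if Disjoint A (E g) then (1 : ℝ) else 0 :=
        mul_le_mul_of_nonneg_left h1 (Nat.cast_nonneg _)
      have : (0 : ℝ) ≤ r := Nat.cast_nonneg _
      linarith
    · have h1 := Finset.sum_nonneg hnn
      have h2 : ((E hex.choose).card : ℝ) ≤ r := by exact_mod_cast (not_le.1 hr).le
      have : (0 : ℝ) ≤ N * ∑ g ∈ G', if Disjoint A (E g) then (1 : ℝ) else 0 := by positivity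
      linarith
  have hdis : ∀ g ∈ G', (∑ A : Finset (Fin N), if Disjoint A (E g) then (1 : ℝ) else 0)
      ≤ 2 ^ N / 2 ^ r := by
    intro g hg
    have hr : r ≤ (E g).card := (Finset.mem_filter.1 hg).2
    have h1 : (∑ A : Finset (Fin N), if Disjoint A (E g) then (1 : ℝ) else 0)
        = ((E g)ᶜ.powerset.card : ℝ) := by
      rw [← Finset.sum_filter, Finset.sum_const, nsmul_eq_mul, mul_one]
      congr 2
      ext A
      simp [Finset.subset_compl_iff_disjoint_right]
    rw [h1, Finset.card_powerset, Finset.card_compl, Fintype.card_fin, le_div_iff₀ (by positivity)]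
    push_cast
    rw [← pow_add]
    refine pow_le_pow_right₀ (by norm_num) ?_
    have : (E g).card ≤ N := (Finset.card_le_univ _).trans (by simp)
    omega
  refine (Finset.sum_le_sum fun A _ => hA A).trans ?_
  rw [Finset.sum_add_distrib, ← Finset.mul_sum, Finset.sum_comm]
  have h1 : (∑ g ∈ G', ∑ A : Finset (Fin N), if Disjoint A (E g) then (1 : ℝ) else 0)
      ≤ B * (2 ^ N / 2 ^ r) := by
    refine (Finset.sum_le_sum hdis).trans ?_
    rw [Finset.sum_const, nsmul_eq_mul]
    refine mul_le_mul_of_nonneg_right ?_ (by positivity)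
    exact_mod_cast (Finset.card_filter_le _ _).trans hB
  have h2 := mul_le_mul_of_nonneg_left h1 (Nat.cast_nonneg N : (0 : ℝ) ≤ N)
  simp only [Finset.sum_const, Finset.card_univ, Fintype.card_finset, Fintype.card_fin,
    nsmul_eq_mul]
  push_cast
  calc _ ≤ (2 : ℝ) ^ N * r + N * (B * (2 ^ N / 2 ^ r)) := by linarith
    _ = _ := by ring

/-- Exchanging ω j with an independent draw i is an involution preserving the product weight. -/
theorem sum_prod_update {n : ℕ} (P : Fin n → ℝ) (j : Fin N)
    (f : (Fin N → Fin n) → Fin n → ℝ) :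
    ∑ ω : Fin N → Fin n, ∑ i, (∏ l, P (ω l)) * P i * f (Function.update ω j i) i
      = (∑ i, P i) * ∑ ω : Fin N → Fin n, (∏ l, P (ω l)) * f ω (ω j) := by
  rw [Finset.sum_mul_sum, Finset.sum_comm, ← Finset.sum_product', ← Finset.sum_product']
  let e : Fin n × (Fin N → Fin n) → Fin n × (Fin N → Fin n) :=
    fun x => (x.2 j, Function.update x.2 j x.1)
  have he : Function.Involutive e := fun x => by simp [e]
  refine Finset.sum_bijective e he.bijective (by simp) fun x _ => ?_
  simp only [e, Function.update_self]
  rw [← Finset.mul_prod_erase _ _ (Finset.mem_univ j),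
    ← Finset.mul_prod_erase _ (fun l => P (Function.update x.2 j x.1 l)) (Finset.mem_univ j)]
  have : ∏ l ∈ Finset.univ.erase j, P (Function.update x.2 j x.1 l)
      = ∏ l ∈ Finset.univ.erase j, P (x.2 l) :=
    Finset.prod_congr rfl fun l hl => by rw [Function.update_of_ne (Finset.ne_of_mem_erase hl)]
  rw [this, Function.update_self]
  ring

open scoped Classical in
theorem card_pairs_not_mem (hN : 0 < N) :
    (∑ A : Finset (Fin N), ∑ j, if j ∈ A then (0 : ℝ) else 1) = N * 2 ^ N / 2 := by
  rw [Finset.sum_comm]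
  have h : ∀ j : Fin N, (∑ A : Finset (Fin N), if j ∈ A then (0 : ℝ) else 1) = 2 ^ N / 2 := by
    intro j
    have h1 : (∑ A : Finset (Fin N), if j ∈ A then (0 : ℝ) else 1)
        = ((Finset.univ.erase j).powerset.card : ℝ) := by
      have : ∀ A : Finset (Fin N), (if j ∈ A then (0 : ℝ) else 1) = if j ∉ A then 1 else 0 := by
        intro A; split_ifs <;> simp_all
      simp only [this]
      rw [← Finset.sum_filter, Finset.sum_const, nsmul_eq_mul, mul_one]
      congr 2
      ext A
      simp [Finset.subset_erase]
    rw [h1, Finset.card_powerset, Finset.card_erase_of_mem (Finset.mem_univ j), Finset.card_univ,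
      Fintype.card_fin]
    obtain ⟨m, rfl⟩ := Nat.exists_eq_succ_of_ne_zero hN.ne'
    push_cast
    rw [pow_succ]
    simp
  simp only [h, Finset.sum_const, Finset.card_univ, Fintype.card_fin, nsmul_eq_mul]
  ring

open scoped Classical in
/-- A small list cover yields a weak learner for every distribution on the sample. -/
theorem exists_weakList {n B r : ℕ} (hN : 0 < N)
    (G : (Fin N → Fin n) → Finset (Fin N → Finset (Fin L))) (hB : ∀ ω, (G ω).card ≤ B)
    (p : Fin n → Fin L) (hcov : ∀ ω, ∃ g ∈ G ω, ∀ i, Hits 3 (g i) (p (ω i)))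
    (P : Fin n → ℝ) (hP : ∀ i, 0 ≤ P i) (hP1 : ∑ i, P i = 1) {η : ℝ}
    (hη : 2 * (r / N + B / 2 ^ r) ≤ η) :
    ∃ (ω : Fin N → Fin n) (A : Finset (Fin N)) (j : Fin N),
      ∑ i, P i * (if Hits 3 (weakList (G (Function.update ω j i)) A j (p ∘ ω)) (p i)
        then (0 : ℝ) else 1) ≤ η := by
  -- Averaging over ω, A and j: if every choice were worse than η, then so would be the mean over
  -- pairs with j outside A. These are half of all pairs, whence the factor 2 in the hypothesis on
  -- η.
  by_contra! hcon
  set W : (Fin N → Fin n) → ℝ := fun ω => ∏ l, P (ω l)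
  have hW : ∀ ω, 0 ≤ W ω := fun ω => Finset.prod_nonneg fun l _ => hP _
  have hW1 : ∑ ω, W ω = 1 := by
    rw [← Fintype.sum_pow, hP1, one_pow]
  let err : Finset (Fin N) → Fin N → (Fin N → Fin n) → ℝ := fun A j ω =>
    if Hits 3 (weakList (G ω) A j (p ∘ ω)) (p (ω j)) then 0 else 1
  let S : Finset (Fin N) → Fin N → ℝ := fun A j => ∑ ω, W ω * err A j ω
  have hlow : ∀ A j, j ∉ A → η < S A j := by
    intro A j hj
    have h1 := sum_prod_update P j fun ω i =>
      if Hits 3 (weakList (G ω) A j (p ∘ ω)) (p i) then (0 : ℝ) else 1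
    rw [hP1, one_mul] at h1
    have h2 : S A j = ∑ ω : Fin N → Fin n, W ω * ∑ i, P i *
        (if Hits 3 (weakList (G (Function.update ω j i)) A j (p ∘ ω)) (p i)
          then (0 : ℝ) else 1) := by
      simp only [S, err, W]
      rw [← h1]
      refine Finset.sum_congr rfl fun ω _ => ?_
      rw [Finset.mul_sum]
      refine Finset.sum_congr rfl fun i _ => ?_
      -- Redrawing ω j changes no label on `A`, as j lies outside `A`.
      rw [weakList_congr _ A j (b := p ∘ Function.update ω j i) (b' := p ∘ ω), mul_assoc]
      intro l hl
      have : l ≠ j := fun h => hj (h ▸ hl)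
      simp [Function.update_of_ne this]
    rw [h2]
    have h3 : η = ∑ ω : Fin N → Fin n, W ω * η := by rw [← Finset.sum_mul, hW1, one_mul]
    rw [h3]
    obtain ⟨ω₀, hω₀⟩ : ∃ ω, 0 < W ω := by
      by_contra! h
      have := Finset.sum_nonpos fun ω (_ : ω ∈ Finset.univ) => h ω
      rw [hW1] at this
      linarith
    exact Finset.sum_lt_sum (fun ω _ => mul_le_mul_of_nonneg_left (hcon ω A j).le (hW ω))
      ⟨ω₀, Finset.mem_univ _, mul_lt_mul_of_pos_left (hcon ω₀ A j) hω₀⟩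
  have hS0 : ∀ A j, 0 ≤ S A j := fun A j => Finset.sum_nonneg fun ω _ =>
    mul_nonneg (hW ω) (by simp only [err]; split_ifs <;> norm_num)
  have hup : (∑ A, ∑ j, S A j) ≤ 2 ^ N * (r + N * (B / 2 ^ r)) := by
    have : (∑ A, ∑ j, S A j) = ∑ ω, W ω * ∑ A, ∑ j, err A j ω := by
      simp only [S, Finset.mul_sum]
      rw [Finset.sum_comm (s := Finset.univ (α := Fin N → Fin n))]
      exact Finset.sum_congr rfl fun A _ => Finset.sum_comm
    rw [this]
    calc _ ≤ ∑ ω, W ω * (2 ^ N * (r + N * (B / 2 ^ r)) : ℝ) :=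
          Finset.sum_le_sum fun ω _ => mul_le_mul_of_nonneg_left
            (count_weakList_errors (G ω) (hB ω) (p ∘ ω) (hcov ω)) (hW ω)
      _ = _ := by rw [← Finset.sum_mul, hW1, one_mul]
  have hlow' : η * (N * 2 ^ N / 2) < ∑ A, ∑ j, S A j := by
    rw [← card_pairs_not_mem hN, Finset.mul_sum]
    have hle : ∀ A j, η * (if j ∈ A then (0 : ℝ) else 1) ≤ S A j := by
      intro A j
      split_ifs with h
      · simpa using hS0 A j
      · simpa using (hlow A j h).le
    refine Finset.sum_lt_sum (fun A _ => ?_) ⟨∅, Finset.mem_univ _, ?_⟩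
    · rw [Finset.mul_sum]
      exact Finset.sum_le_sum fun j _ => hle A j
    · rw [Finset.mul_sum]
      exact Finset.sum_lt_sum (fun j _ => hle ∅ j)
        ⟨⟨0, hN⟩, Finset.mem_univ _, by simpa using hlow ∅ ⟨0, hN⟩ (by simp)⟩
  have hN' : (0 : ℝ) < N := by exact_mod_cast hN
  have h5 : (2 : ℝ) ^ N * (r + N * (B / 2 ^ r)) = 2 * (r / N + B / 2 ^ r) * (N * 2 ^ N / 2) := by
    field_simp
  have h6 := mul_le_mul_of_nonneg_right hη (by positivity : (0 : ℝ) ≤ N * 2 ^ N / 2)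
  linarith

end Weak

/-! ### Boosting -/

open scoped Classical in
/-- Boosting by multiplicative weights: weak hypotheses for all distributions combine to a
sequence of hypotheses in which no point is mistaken often. -/
theorem exists_boosted {Θ : Type*} {n : ℕ} (hn : 0 < n) (e : Θ → Fin n → Prop) {η : ℝ}
    (hweak : ∀ P : Fin n → ℝ, (∀ i, 0 ≤ P i) → ∑ i, P i = 1 →
      ∃ θ, ∑ i, P i * (if e θ i then 1 else 0) ≤ η) (T : ℕ) :
    ∃ θ : Fin T → Θ, ∑ i, (2 : ℝ) ^ (Finset.univ.filter fun t => e (θ t) i).card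
      ≤ n * (1 + η) ^ T := by
  induction T with
  | zero => exact ⟨Fin.elim0, by simp⟩
  | succ T ih =>
    obtain ⟨θ, hθ⟩ := ih
    set w : Fin n → ℝ := fun i => (2 : ℝ) ^ (Finset.univ.filter fun t => e (θ t) i).card
    have hw : ∀ i, 0 < w i := fun i => by positivity
    have hΦ : 0 < ∑ i, w i := Finset.sum_pos (fun i _ => hw i) ⟨⟨0, hn⟩, Finset.mem_univ _⟩
    -- The weight of a point doubles with each mistake, so a weak hypothesis for the normalized
    -- weights multiplies their total by at most 1 + η.
    obtain ⟨θ', hθ'⟩ := hweak (fun i => w i / ∑ i, w i) (fun i => (div_pos (hw i) hΦ).le)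
      (by rw [← Finset.sum_div, div_self hΦ.ne'])
    refine ⟨Fin.cons θ' θ, ?_⟩
    have h1 : ∀ i, (2 : ℝ) ^ (Finset.univ.filter fun t : Fin (T + 1) =>
        e ((Fin.cons θ' θ : Fin (T + 1) → Θ) t) i).card
        = w i + w i * (if e θ' i then 1 else 0) := by
      intro i
      have : (Finset.univ.filter fun t : Fin (T + 1) =>
        e ((Fin.cons θ' θ : Fin (T + 1) → Θ) t) i).card
          = (if e θ' i then 1 else 0) + (Finset.univ.filter fun t => e (θ t) i).card := by
        rw [Fin.card_filter_univ_succ]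
        simp only [Fin.cons_zero, Fin.cons_succ]
        split_ifs <;> omega
      rw [this, pow_add]
      split_ifs
      · simp [w]
        ring
      · simp [w]
    simp only [h1]
    rw [Finset.sum_add_distrib]
    have h2 : ∑ i, w i * (if e θ' i then (1 : ℝ) else 0) ≤ η * ∑ i, w i := by
      have h3 := mul_le_mul_of_nonneg_right hθ' hΦ.le
      rw [Finset.sum_mul] at h3
      refine le_trans (le_of_eq (Finset.sum_congr rfl fun i _ => ?_)) h3
      field_simp
    have hη : 0 ≤ η := by
      refine le_trans (Finset.sum_nonneg fun i _ => ?_) hθ'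
      exact mul_nonneg (div_pos (hw i) hΦ).le (by split_ifs <;> norm_num)
    calc _ ≤ (1 + η) * ∑ i, w i := by linarith
      _ ≤ (1 + η) * (n * (1 + η) ^ T) := mul_le_mul_of_nonneg_left hθ (by linarith)
      _ = _ := by ring

open scoped Classical in
/-- With enough rounds, boosting leaves a fraction less than `1 / (k + 1)` of mistakes. -/
theorem exists_boosted_majority {Θ : Type*} {n k T : ℕ} (hn : 0 < n) (e : Θ → Fin n → Prop)
    (hweak : ∀ P : Fin n → ℝ, (∀ i, 0 ≤ P i) → ∑ i, P i = 1 →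
      ∃ θ, ∑ i, P i * (if e θ i then 1 else 0) ≤ 1 / (4 * (k + 1 : ℝ)))
    (hT : 4 * (k + 1) * (Real.log n + 1) ≤ T) :
    ∃ θ : Fin T → Θ, ∀ i, (Finset.univ.filter fun t => e (θ t) i).card * (k + 1) < T := by
  obtain ⟨θ, hθ⟩ := exists_boosted (η := 1 / (4 * (k + 1 : ℝ))) hn e hweak T
  refine ⟨θ, fun i => ?_⟩
  have hlog : 0 ≤ Real.log n := Real.log_natCast_nonneg n
  set m := (Finset.univ.filter fun t => e (θ t) i).card with hm
  have h1 : (2 : ℝ) ^ m ≤ n * (1 + 1 / (4 * (k + 1 : ℝ))) ^ T := by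
    refine le_trans ?_ hθ
    exact Finset.single_le_sum
      (f := fun i => (2 : ℝ) ^ (Finset.univ.filter fun t => e (θ t) i).card)
      (fun i _ => by positivity) (Finset.mem_univ i)
  have hn' : (0 : ℝ) < n := by exact_mod_cast hn
  have hk : (0 : ℝ) < k + 1 := by positivity
  have h2 : m * Real.log 2 ≤ Real.log n + T * (1 / (4 * (k + 1 : ℝ))) := by
    have h3 := Real.log_le_log (by positivity) h1
    rw [Real.log_pow, Real.log_mul hn'.ne' (by positivity), Real.log_pow] at h3
    have h4 : Real.log (1 + 1 / (4 * (k + 1 : ℝ))) ≤ 1 / (4 * (k + 1 : ℝ)) := by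
      have := Real.log_le_sub_one_of_pos (x := 1 + 1 / (4 * (k + 1 : ℝ))) (by positivity)
      linarith
    have := mul_le_mul_of_nonneg_left h4 (Nat.cast_nonneg T)
    linarith
  have h5 : (m * (k + 1) : ℝ) * Real.log 2 ≤ (k + 1) * Real.log n + T / 4 := by
    have := mul_le_mul_of_nonneg_right h2 hk.le
    have e : (T : ℝ) * (1 / (4 * (k + 1 : ℝ))) * (k + 1) = T / 4 := by field_simp
    linarith
  have hlog2 : (0.69 : ℝ) < Real.log 2 := by
    have := Real.log_two_gt_d9
    linarith
  -- A point missed in at least T/(k+1) rounds would give 0.69 T ≤ (k+1) log n + T/4 < T/2.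
  by_contra! hge
  have hge' : (T : ℝ) ≤ m * (k + 1) := by exact_mod_cast hge
  have h6 : (T : ℝ) * 0.69 ≤ (m * (k + 1) : ℝ) * Real.log 2 :=
    mul_le_mul hge' hlog2.le (by norm_num) (by positivity)
  nlinarith [mul_nonneg hk.le hlog]

/-! ### Merging many lists into one -/

section Combine

variable {T L : ℕ}

open scoped Classical in
/-- A list of at most `k` values close to all values hit by most of the given lists. -/
def combine (k : ℕ) (ℓ : Fin T → Finset (Fin L)) : Finset (Fin L) :=
  if h : ∃ s : Finset (Fin L), s.card ≤ k ∧ ∀ v, k * T <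
      (Finset.univ.filter fun t => Hits 3 (ℓ t) v).card * (k + 1) → Hits 5 s v
  then h.choose else ∅

theorem card_combine_le (k : ℕ) (ℓ : Fin T → Finset (Fin L)) : (combine k ℓ).card ≤ k := by
  unfold combine
  split_ifs with h
  · exact h.choose_spec.1
  · simp

-- Along a chain with gaps at least 5, an element of a list is within distance 2 of at most one
-- chain member. A list of size k therefore hits at most k of k + 1 members, and by double counting
-- not all of them can be hit by more than a fraction k/(k+1) of the lists.
open scoped Classical in
theorem hits_combine {k : ℕ} {ℓ : Fin T → Finset (Fin L)} (hℓ : ∀ t, (ℓ t).card ≤ k) {v : Fin L}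
    (hv : (Finset.univ.filter fun t => ¬ Hits 3 (ℓ t) v).card * (k + 1) < T) :
    Hits 5 (combine k ℓ) v := by
  have hex : ∃ s : Finset (Fin L), s.card ≤ k ∧ ∀ v, k * T <
      (Finset.univ.filter fun t => Hits 3 (ℓ t) v).card * (k + 1) → Hits 5 s v := by
    refine exists_net k {v | k * T <
      (Finset.univ.filter fun t => Hits 3 (ℓ t) v).card * (k + 1)} fun c hc hall => ?_
    have h1 : ∑ j, (Finset.univ.filter fun t => Hits 3 (ℓ t) (c j)).card
        = ∑ t, (Finset.univ.filter fun j => Hits 3 (ℓ t) (c j)).card := by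
      simp only [Finset.card_filter]
      rw [Finset.sum_comm]
    have h2 : ∀ t, (Finset.univ.filter fun j => Hits 3 (ℓ t) (c j)).card ≤ k := by
      intro t
      refine le_trans ?_ (hℓ t)
      have : Nonempty (Fin L) := ⟨c 0⟩
      choose! a ha using fun j (hj : Hits 3 (ℓ t) (c j)) => hj
      refine Finset.card_le_card_of_injOn a ?_ ?_
      · intro j hj
        exact (ha j (by simpa using hj)).1
      · intro j hj j' hj' h
        have e1 := (ha j (by simpa using hj)).2
        have e2 := (ha j' (by simpa using hj')).2
        rw [← h] at e2
        rcases lt_trichotomy j j' with hlt | heq | hlt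
        · have := hc j j' hlt
          omega
        · exact heq
        · have := hc j' j hlt
          omega
    have h3 : ∑ j, (Finset.univ.filter fun t => Hits 3 (ℓ t) (c j)).card ≤ k * T := by
      rw [h1]
      refine (Finset.sum_le_sum fun t _ => h2 t).trans ?_
      simp [mul_comm]
    have h4 : ∑ _j : Fin (k + 1), k * T
        < ∑ j, (Finset.univ.filter fun t => Hits 3 (ℓ t) (c j)).card * (k + 1) :=
      Finset.sum_lt_sum_of_nonempty ⟨0, Finset.mem_univ _⟩ fun j _ => hall j
    have h5 := Nat.mul_le_mul_right (k + 1) h3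
    rw [Finset.sum_mul] at h5
    simp only [Finset.sum_const, Finset.card_univ, Fintype.card_fin, smul_eq_mul] at h4
    linarith
  unfold combine
  rw [dif_pos hex]
  refine hex.choose_spec.2 v ?_
  have h5 : (Finset.univ.filter fun t => Hits 3 (ℓ t) v).card
      + (Finset.univ.filter fun t => ¬ Hits 3 (ℓ t) v).card = T := by
    rw [Finset.card_filter_add_card_filter_not]
    simp
  nlinarith

end Combine

/-! ### Discretization and the compression scheme -/

section Compression

variable {X : Type*} (H : Set (X → I)) (γ : ℝ)

/-- The number of grid points needed at scale `γ`. -/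
def gridSize (γ : ℝ) : ℕ := ⌈1 / γ⌉₊ + 1

/-- The open interval of radius `γ` around the grid point `a * γ`. -/
def bin (γ : ℝ) (a : ℕ) : Set I := {v | |(v : ℝ) - a * γ| < γ}

/-- Open overlapping bins are used because weak measurability of the class only speaks of open sets.
-/
theorem isOpen_bin (a : ℕ) : IsOpen (bin γ a) :=
  isOpen_lt (by fun_prop) continuous_const

/-- The discretized restrictions of `H` to `z`. -/
def patterns {N : ℕ} (z : Fin N → X) : Set (Fin N → Fin (gridSize γ)) :=
  {p | ∃ h ∈ H, ∀ i, h (z i) ∈ bin γ (p i)}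

variable {H γ}

theorem gridSize_mul_le (hγ : 0 < γ) : (gridSize γ : ℝ) * γ ≤ 1 + 2 * γ := by
  have h := (Nat.ceil_lt_add_one (one_div_pos.2 hγ).le).le
  unfold gridSize
  push_cast
  have := mul_le_mul_of_nonneg_right h hγ.le
  have e : (1 / γ + 1) * γ = 1 + γ := by field_simp
  linarith

theorem exists_mem_bin (hγ : 0 < γ) (v : I) : ∃ a : Fin (gridSize γ), v ∈ bin γ a := by
  have hv : 0 ≤ (v : ℝ) / γ := div_nonneg v.2.1 hγ.le
  refine ⟨⟨⌊(v : ℝ) / γ⌋₊, ?_⟩, ?_⟩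
  · have h1 : (v : ℝ) / γ ≤ 1 / γ := div_le_div_of_nonneg_right v.2.2 hγ.le
    exact Nat.lt_succ_of_le ((Nat.floor_le_floor h1).trans (Nat.floor_le_ceil _))
  · have h1 := Nat.floor_le hv
    have h2 := Nat.lt_floor_add_one ((v : ℝ) / γ)
    rw [le_div_iff₀ hγ] at h1
    rw [div_lt_iff₀ hγ] at h2
    simp only [bin, Set.mem_ofPred_eq, abs_lt]
    constructor <;> nlinarith

/-- A gap 3γ consists of two bin radii and two margins γ/2. The anchor is therefore placed 3γ/2
below the upper grid point of each consecutive pair. -/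
theorem card_support_le {N k : ℕ} (hγ : 0 < γ) (hfin : fatDim H (γ / 2) k ≠ ⊤)
    (z : Fin N → X) (w : Fin N → Option (Fin (k + 1) → Fin (gridSize γ)))
    (hw : Shat (patterns H γ z) w) :
    (Finset.univ.filter fun i => w i ≠ none).card ≤ (fatDim H (γ / 2) k).toNat := by
  classical
  set S := Finset.univ.filter fun i => w i ≠ none
  let e := S.equivFin.symm
  have hc : ∀ i : Fin S.card, ∃ c, w (e i) = some c := by
    intro i
    have := (Finset.mem_filter.1 (e i).2).2
    exact Option.ne_none_iff_exists'.1 this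
  choose c hc using hc
  have hsp : ∀ i (j : Fin k), ((c i j.castSucc : ℕ) : ℝ) + 3 ≤ (c i j.succ : ℕ) := by
    intro i j
    exact_mod_cast hw.1 _ _ (hc i) j.castSucc j.succ Fin.castSucc_lt_succ
  have hL := gridSize_mul_le hγ
  have hshat : FatShatters H (γ / 2) k (fun i => z (e i)) := by
    refine ⟨fun i j => ⟨(c i j.succ : ℕ) * γ - γ - γ / 2, ?_, ?_⟩, ?_, ?_⟩
    · have h0 : (0 : ℝ) ≤ (c i j.castSucc : ℕ) := Nat.cast_nonneg _
      nlinarith [hsp i j]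
    · have h1 : ((c i j.succ : ℕ) : ℝ) + 1 ≤ gridSize γ := by exact_mod_cast (c i j.succ).2
      nlinarith
    · intro i j j' hj
      have h1 : (j.succ : Fin (k + 1)) = j'.castSucc := Fin.ext (by simp [hj])
      have := hsp i j'
      rw [← h1] at this
      simp only
      nlinarith
    · intro b
      obtain ⟨p, ⟨h, hh, hbin⟩, hp⟩ := hw.2
        (fun i => if hi : i ∈ S then b (e.symm ⟨i, hi⟩) else 0)
      refine ⟨h, hh, fun i j => ?_⟩
      have h1 := hp _ _ (hc i)
      rw [dif_pos (e i).2] at h1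
      simp only [Subtype.coe_eta, Equiv.symm_apply_apply] at h1
      have h2 := hbin (e i)
      rw [h1] at h2
      simp only [bin, Set.mem_ofPred_eq, abs_lt] at h2
      constructor
      · intro hb
        have : b i = j.succ := Fin.ext (by simp [hb])
        rw [this] at h2
        simp only
        linarith
      · intro hb
        have : b i = j.castSucc := Fin.ext (by simp [hb])
        rw [this] at h2
        simp only
        nlinarith [hsp i j]
  have hle : (S.card : ℕ∞) ≤ fatDim H (γ / 2) k :=
    le_iSup₂_of_le (f := fun (d : ℕ) (_ : ∃ x : Fin d → X, FatShatters H (γ / 2) k x) => (d : ℕ∞))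
      S.card ⟨_, hshat⟩ le_rfl
  rw [← ENat.natCast_toNat hfin] at hle
  exact_mod_cast hle

open scoped Classical in
/-- A list cover of `F` of size `B`, if there is one. -/
def coverOf {N L : ℕ} (k B : ℕ) (F : Set (Fin N → Fin L)) : Finset (Fin N → Finset (Fin L)) :=
  if h : ListCover k F B then h.choose else ∅

theorem card_coverOf_apply_le {N L : ℕ} (k B : ℕ) (F : Set (Fin N → Fin L)) :
    ∀ g ∈ coverOf k B F, ∀ i, (g i).card ≤ k := by
  unfold coverOf
  split_ifs with h
  · exact h.choose_spec.2.1
  · simp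

/-- The data from which a list hypothesis of a boosting round is built: indices of sample points,
positions of the training points, position of the test point and discretized labels. -/
abbrev Desc (n N L : ℕ) : Type := (Fin N → Fin n) × Finset (Fin N) × Fin N × (Fin N → Fin L)

/-- The combined list of all boosting rounds, given the discretized restrictions of the class. -/
def gridList {n N L T : ℕ} (k B : ℕ) (θ : Fin T → Desc n N L)
    (F : Fin T → Set (Fin N → Fin L)) : Finset (Fin L) :=
  combine k fun t => weakList (coverOf k B (F t)) (θ t).2.1 (θ t).2.2.1 (θ t).2.2.2

open scoped Classical in
/-- The list of the grid points with indices in `s`. -/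
def toList (γ : ℝ) (k : ℕ) {L : ℕ} (s : Finset (Fin L)) : Fin k → I := fun j =>
  if h : (j : ℕ) < s.card then
    Set.projIcc (0 : ℝ) 1 zero_le_one ((s.equivFin.symm ⟨j, h⟩ : Fin L) * γ) else 0

/-- Hitting means an index distance at most m - 1, and the bin radius adds one more γ; clipping to
[0,1] does not increase distances. -/
theorem exists_toList_near {k L m : ℕ} {s : Finset (Fin L)} (hs : s.card ≤ k)
    {p : Fin L} (hp : Hits m s p) (hγ : 0 < γ) {v : I} (hv : v ∈ bin γ p) :
    ∃ j, |(toList γ k s j : ℝ) - v| ≤ m * γ := by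
  obtain ⟨a, ha, h1, h2⟩ := hp
  have hlt := (s.equivFin ⟨a, ha⟩).2
  refine ⟨⟨s.equivFin ⟨a, ha⟩, hlt.trans_le hs⟩, ?_⟩
  have e : toList γ k s ⟨s.equivFin ⟨a, ha⟩, hlt.trans_le hs⟩
      = Set.projIcc (0 : ℝ) 1 zero_le_one (a * γ) := by
    simp [toList]
  have e2 : (v : ℝ) = Set.projIcc (0 : ℝ) 1 zero_le_one (v : ℝ) := by
    rw [Set.projIcc_val]
  rw [e, e2]
  refine (Set.abs_projIcc_sub_projIcc _).trans ?_
  simp only [bin, Set.mem_ofPred_eq, abs_lt] at hv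
  have h1' : ((a : ℕ) : ℝ) + 1 ≤ (p : ℕ) + m := by exact_mod_cast h1
  have h2' : ((p : ℕ) : ℝ) + 1 ≤ (a : ℕ) + m := by exact_mod_cast h2
  rw [abs_le]
  constructor <;> nlinarith

variable (H γ) in
/-- The list hypothesis reconstructed from the sample points `x` selected by `θ`. -/
def recon {n N T : ℕ} (k B : ℕ) (θ : Fin T → Desc n N (gridSize γ)) (x : Fin n → X) (u : X) :
    Fin k → I :=
  toList γ k (gridList k B θ fun t =>
    patterns H γ (Function.update (x ∘ (θ t).1) (θ t).2.2.1 u))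

/-- Every hypothesis is approximated on the whole sample by a reconstructed list hypothesis. -/
theorem exists_recon_near {n N T k r s : ℕ} (hγ : 0 < γ) (hk : 1 ≤ k) (hn : 0 < n) (hN : 0 < N)
    (hfin : fatDim H (γ / 2) k ≠ ⊤)
    (hr : (N * gridSize γ ^ (k + 1) + 1) ^ (fatDim H (γ / 2) k).toNat * k ^ r < (k + 1) ^ r)
    (hs : 2 * (s / N + ((N * gridSize γ + 1) ^ r : ℕ) / 2 ^ s) ≤ 1 / (4 * (k + 1 : ℝ)))
    (hT : 4 * (k + 1) * (Real.log n + 1) ≤ T) (x : Fin n → X) {h : X → I} (hh : h ∈ H) :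
    ∃ θ : Fin T → Desc n N (gridSize γ), ∀ i, ∃ j,
      |(recon H γ k ((N * gridSize γ + 1) ^ r) θ x (x i) j : ℝ) - h (x i)| ≤ 5 * γ := by
  classical
  set B := (N * gridSize γ + 1) ^ r
  choose p hp using fun i => exists_mem_bin hγ (h (x i))
  have hcover : ∀ z : Fin N → X, ListCover k (patterns H γ z) B := by
    intro z
    have := listCover_of_dim (ι := Fin N) hk (r := r) (patterns H γ z)
      (card_support_le hγ hfin z) (by simpa using hr)
    simpa using this
  let G : (Fin N → Fin n) → Finset (Fin N → Finset (Fin (gridSize γ))) := fun ω =>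
    coverOf k B (patterns H γ (x ∘ ω))
  have hG : ∀ ω, G ω = (hcover (x ∘ ω)).choose := fun ω => dif_pos (hcover (x ∘ ω))
  obtain ⟨θ, hθ⟩ := exists_boosted_majority (Θ := Desc n N (gridSize γ)) (k := k) (T := T) hn
    (fun θ i => ¬ Hits 3 (weakList (coverOf k B (patterns H γ
      (Function.update (x ∘ θ.1) θ.2.2.1 (x i)))) θ.2.1 θ.2.2.1 θ.2.2.2) (p i))
    (by
      intro P hP hP1
      obtain ⟨ω, A, j, hω⟩ := exists_weakList hN G
        (fun ω => by rw [hG]; exact (hcover (x ∘ ω)).choose_spec.1) p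
        (fun ω => by
          rw [hG]
          exact (hcover (x ∘ ω)).choose_spec.2.2 (p ∘ ω) ⟨h, hh, fun i => hp (ω i)⟩)
        P hP hP1 hs
      -- The description records the rounded values of h at the chosen points, not the observed
      -- labels.
      refine ⟨(ω, A, j, p ∘ ω), le_trans (le_of_eq ?_) hω⟩
      refine Finset.sum_congr rfl fun i _ => ?_
      simp only [G, Function.comp_update]
      congr 1
      split_ifs <;> rfl)
    hT
  refine ⟨θ, fun i => ?_⟩
  have h5 : Hits 5 (gridList k B θ fun t =>
      patterns H γ (Function.update (x ∘ (θ t).1) (θ t).2.2.1 (x i))) (p i) :=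
    hits_combine (fun t => card_weakList_le (card_coverOf_apply_le _ _ _) _ _ _) (by convert hθ i)
  obtain ⟨j, hj⟩ := exists_toList_near (card_combine_le k _) h5 hγ (hp i)
  exact ⟨j, hj⟩

end Compression

/-! ### The list loss and its expectation -/

section Loss

variable {k : ℕ}

theorem listLoss_nonneg (μ : Fin k → I) (y : I) : 0 ≤ listLoss μ y :=
  Real.iInf_nonneg fun _ => abs_nonneg _

theorem listLoss_le (μ : Fin k → I) (y : I) (j : Fin k) : listLoss μ y ≤ |(μ j : ℝ) - y| :=
  ciInf_le ⟨0, by rintro _ ⟨j, rfl⟩; exact abs_nonneg _⟩ j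

theorem abs_coe_sub_coe_le_one (u v : I) : |(u : ℝ) - v| ≤ 1 := by
  rw [abs_le]
  constructor <;> linarith [u.2.1, u.2.2, v.2.1, v.2.2]

theorem listLoss_le_one (μ : Fin k → I) (y : I) : listLoss μ y ≤ 1 := by
  rcases Nat.eq_zero_or_pos k with rfl | hk
  · simp [listLoss]
  · exact (listLoss_le μ y ⟨0, hk⟩).trans (abs_coe_sub_coe_le_one _ _)

theorem measurable_listLoss : Measurable fun q : (Fin k → I) × I => listLoss q.1 q.2 := by
  unfold listLoss
  exact Measurable.iInf fun j => by fun_prop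

theorem listLoss_one (u y : I) : listLoss (fun _ : Fin 1 => u) y = |(u : ℝ) - y| := by
  simp [listLoss]

theorem listLoss_le_add {μ : Fin k → I} {u : I} {a : ℝ} {j : Fin k} (h : |(μ j : ℝ) - u| ≤ a)
    (y : I) : listLoss μ y ≤ listLoss (fun _ : Fin 1 => u) y + a := by
  rw [listLoss_one]
  have h1 := abs_sub_le (μ j : ℝ) u y
  linarith [listLoss_le μ y j]

variable {X : Type*} [MeasurableSpace X] (D : Measure (X × I))

theorem listErr_nonneg (μ : X → Fin k → I) : 0 ≤ listErr D μ :=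
  integral_nonneg fun _ => listLoss_nonneg _ _

theorem listErr_le_one [IsProbabilityMeasure D] (μ : X → Fin k → I) : listErr D μ ≤ 1 := by
  have h := norm_integral_le_of_norm_le_const (μ := D) (C := 1)
    (f := fun z : X × I => listLoss (μ z.1) z.2)
    (Filter.Eventually.of_forall fun z => by
      rw [Real.norm_of_nonneg (listLoss_nonneg _ _)]
      exact listLoss_le_one _ _)
  simp only [probReal_univ, mul_one] at h
  exact (le_abs_self _).trans h

variable {D}

theorem quasiMeasurePreserving_fst_fst :
    Measure.QuasiMeasurePreserving (Prod.fst : X × I → X) D D.fst :=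
  (MeasurePreserving.mk measurable_fst rfl : MeasurePreserving _ D D.fst).quasiMeasurePreserving

theorem aemeasurable_listLoss {μ : X → Fin k → I} (h : AEMeasurable μ D.fst) :
    AEMeasurable (fun z : X × I => listLoss (μ z.1) z.2) D := by
  have h1 : AEMeasurable (fun z : X × I => μ z.1) D :=
    h.comp_quasiMeasurePreserving quasiMeasurePreserving_fst_fst
  have h2 : AEMeasurable (fun z : X × I => (μ z.1, z.2)) D :=
    h1.prodMk measurable_snd.aemeasurable
  exact Measurable.comp_aemeasurable (g := fun q : (Fin k → I) × I => listLoss q.1 q.2)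
    (f := fun z : X × I => (μ z.1, z.2)) measurable_listLoss h2

theorem integrable_listLoss [IsProbabilityMeasure D] {μ : X → Fin k → I}
    (h : AEMeasurable μ D.fst) : Integrable (fun z : X × I => listLoss (μ z.1) z.2) D :=
  Integrable.of_mem_Icc 0 1 (aemeasurable_listLoss h)
    (Filter.Eventually.of_forall fun _ => ⟨listLoss_nonneg _ _, listLoss_le_one _ _⟩)

theorem listErr_congr {μ ν : X → Fin k → I} (h : μ =ᵐ[D.fst] ν) : listErr D μ = listErr D ν := by
  refine integral_congr_ae ?_
  filter_upwards [quasiMeasurePreserving_fst_fst.ae_eq_comp h] with z hz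
  simp only [Function.comp_apply] at hz
  simp only [hz]

end Loss

/-! ### Concentration -/

section Hoeffding

variable {Z ι : Type*} [MeasurableSpace Z] [Fintype ι] (D : Measure Z) [IsProbabilityMeasure D]

open ProbabilityTheory in
/-- One-sided Hoeffding inequality for the mean of a function with values in `[0, 1]`. -/
theorem measure_sum_le_le {g : Z → ℝ} (hg : AEMeasurable g D) (h01 : ∀ z, g z ∈ Set.Icc (0 : ℝ) 1)
    {t : ℝ} (ht : 0 ≤ t) :
    (Measure.pi fun _ : ι => D)
      {S | ∑ i, g (S i) + Fintype.card ι * t ≤ Fintype.card ι * ∫ z, g z ∂D}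
      ≤ ENNReal.ofReal (Real.exp (-2 * Fintype.card ι * t ^ 2)) := by
  set m : ℝ := (Fintype.card ι : ℝ) with hm
  have hsub : HasSubgaussianMGF (fun z => (∫ z, g z ∂D) - g z) ((‖(1 : ℝ) - 0‖₊ / 2) ^ 2) D := by
    have := (hasSubgaussianMGF_of_mem_Icc hg (Filter.Eventually.of_forall h01)).neg
    refine this.congr (Filter.Eventually.of_forall fun z => ?_)
    simp
  have hind : iIndepFun (fun (i : ι) (S : ι → Z) => (∫ z, g z ∂D) - g (S i))
      (Measure.pi fun _ : ι => D) :=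
    iIndepFun_pi (X := fun _ z => (∫ z, g z ∂D) - g z) fun _ => hg.const_sub _
  have hsub' : ∀ i ∈ (Finset.univ : Finset ι),
      HasSubgaussianMGF (fun S : ι → Z => (∫ z, g z ∂D) - g (S i)) ((‖(1 : ℝ) - 0‖₊ / 2) ^ 2)
        (Measure.pi fun _ : ι => D) := by
    intro i _
    have hmp := measurePreserving_eval (fun _ : ι => D) i
    refine HasSubgaussianMGF.of_map (X := fun z => (∫ z, g z ∂D) - g z) (Y := fun S : ι → Z => S i)
      hmp.measurable.aemeasurable ?_
    rw [hmp.map_eq]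
    exact hsub
  have h := HasSubgaussianMGF.measure_sum_ge_le_of_iIndepFun hind hsub'
    (ε := m * t) (by positivity)
  have hset : {S : ι → Z | ∑ i, g (S i) + m * t ≤ m * ∫ z, g z ∂D}
      = {S | m * t ≤ ∑ i, ((∫ z, g z ∂D) - g (S i))} := by
    ext S
    simp only [Set.mem_ofPred_eq, Finset.sum_sub_distrib, Finset.sum_const, Finset.card_univ,
      nsmul_eq_mul]
    constructor <;> intro h <;> linarith
  rw [hset, ← ofReal_measureReal]
  refine ENNReal.ofReal_le_ofReal (h.trans (le_of_eq ?_))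
  congr 1
  simp only [sub_zero, nnnorm_one, Finset.sum_const, Finset.card_univ, nsmul_eq_mul]
  push_cast
  change -(m * t) ^ 2 / (2 * (m * (1 / 2) ^ 2)) = _
  rcases eq_or_ne m 0 with h0 | h0
  · simp [h0]
  · field_simp

end Hoeffding

/-! ### Generalization from unused sample points -/

section Generalization

variable {X : Type*} [MeasurableSpace X] {n k : ℕ} (D : Measure (X × I)) [IsProbabilityMeasure D]

/-- A list hypothesis that depends only on the sample points with index in `J` generalizes from
the remaining ones. -/
theorem measure_generalization_le (J : Finset (Fin n))
    (f : ({i // i ∈ J} → X × I) × X → Fin k → I)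
    (hf : AEMeasurable f ((Measure.pi fun _ : {i // i ∈ J} => D).prod D.fst)) {t : ℝ}
    (ht : 0 ≤ t) :
    (Measure.pi fun _ : Fin n => D)
      {S | ¬ (AEMeasurable (fun x => f (fun i => S i, x)) D.fst ∧
        (n - J.card : ℝ) * listErr D (fun x => f (fun i => S i, x)) ≤
          (∑ i : {i // i ∉ J}, listLoss (f (fun i => S i, (S i).1)) (S i).2)
            + (n - J.card : ℝ) * t)}
      ≤ ENNReal.ofReal (Real.exp (-2 * (n - J.card) * t ^ 2)) := by
  classical
  obtain ⟨g, hgm, hfg⟩ := hf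
  set μJ := Measure.pi fun _ : {i // i ∈ J} => D
  set μC := Measure.pi fun _ : {i // i ∉ J} => D
  have hmp : MeasurePreserving (MeasurableEquiv.piEquivPiSubtypeProd (fun _ => X × I) (· ∈ J))
      (Measure.pi fun _ : Fin n => D) (μJ.prod μC) := by
    convert measurePreserving_piEquivPiSubtypeProd (fun _ : Fin n => D) (· ∈ J)
  have hcard : (Fintype.card {i // i ∉ J} : ℝ) = n - J.card := by
    rw [Fintype.card_subtype_compl, Fintype.card_fin, Fintype.card_coe, Nat.cast_sub]
    simpa using Finset.card_le_univ J
  -- For almost every sample the measurable representative `g` agrees with `f` at almost every new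
  -- point and at each held-out point, so both errors may be computed with `g`.
  have hae1 : ∀ᵐ q ∂(μJ.prod μC), (fun x => f (q.1, x)) =ᵐ[D.fst] fun x => g (q.1, x) :=
    (measurePreserving_fst (μ := μJ) (ν := μC)).quasiMeasurePreserving.ae
      (Measure.ae_ae_of_ae_prod hfg)
  have hae2 : ∀ᵐ q ∂(μJ.prod μC), ∀ i : {i // i ∉ J}, f (q.1, (q.2 i).1) = g (q.1, (q.2 i).1) := by
    rw [ae_all_iff]
    intro i
    have h1 : MeasurePreserving (fun u : {i // i ∉ J} → X × I => (u i).1) μC D.fst :=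
      (MeasurePreserving.mk measurable_fst rfl : MeasurePreserving _ D D.fst).comp
        (measurePreserving_eval (fun _ => D) i)
    exact ((MeasurePreserving.id μJ).prod h1).quasiMeasurePreserving.ae hfg
  have hlossm : Measurable fun w : ({i // i ∈ J} → X × I) × (X × I) =>
      listLoss (g (w.1, w.2.1)) w.2.2 :=
    Measurable.comp (g := fun q : (Fin k → I) × I => listLoss q.1 q.2)
      (f := fun w : ({i // i ∈ J} → X × I) × (X × I) => (g (w.1, w.2.1), w.2.2))
      measurable_listLoss ((hgm.comp (by fun_prop)).prodMk (by fun_prop))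
  have herrm : Measurable fun u : {i // i ∈ J} → X × I => listErr D fun x => g (u, x) := by
    unfold listErr
    exact (hlossm.stronglyMeasurable.integral_prod_right' (ν := D)).measurable
  let bad : Set (({i // i ∈ J} → X × I) × ({i // i ∉ J} → X × I)) :=
    {q | ∑ i, listLoss (g (q.1, (q.2 i).1)) (q.2 i).2 + (n - J.card : ℝ) * t
      ≤ (n - J.card : ℝ) * listErr D (fun x => g (q.1, x))}
  have hbadm : MeasurableSet bad := by
    refine measurableSet_le ?_ ?_
    · refine Measurable.add_const (Finset.measurable_sum _ fun i _ => ?_) _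
      exact Measurable.comp (g := fun w : ({i // i ∈ J} → X × I) × (X × I) =>
        listLoss (g (w.1, w.2.1)) w.2.2)
        (f := fun q : ({i // i ∈ J} → X × I) × ({i // i ∉ J} → X × I) => (q.1, q.2 i))
        hlossm (by fun_prop)
    · exact (herrm.comp measurable_fst).const_mul _
  have hbad : (μJ.prod μC) bad ≤ ENNReal.ofReal (Real.exp (-2 * (n - J.card) * t ^ 2)) := by
    -- Once the coordinates in `J` are frozen the hypothesis is fixed and the others are still
    -- i.i.d.
    refine (Measure.prod_apply_le hbadm).trans ?_
    calc _ ≤ ∫⁻ _, ENNReal.ofReal (Real.exp (-2 * (n - J.card) * t ^ 2)) ∂μJ := by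
          refine lintegral_mono fun u => ?_
          have := measure_sum_le_le (ι := {i // i ∉ J}) D
            (g := fun z => listLoss (g (u, z.1)) z.2)
            (Measurable.comp (g := fun w : ({i // i ∈ J} → X × I) × (X × I) =>
              listLoss (g (w.1, w.2.1)) w.2.2) (f := fun z : X × I => (u, z))
              hlossm (by fun_prop)).aemeasurable
            (fun z => ⟨listLoss_nonneg _ _, listLoss_le_one _ _⟩) ht
          rw [hcard] at this
          exact this
      _ = _ := by simp
  refine (measure_mono_ae ?_).trans ((hmp.measure_preimage hbadm.nullMeasurableSet).trans_le hbad)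
  have e1 := hmp.quasiMeasurePreserving.ae hae1
  have e2 := hmp.quasiMeasurePreserving.ae hae2
  filter_upwards [e1, e2] with S h1 h2 hS
  change (fun x => f (fun i => S i, x)) =ᵐ[D.fst] fun x => g (fun i => S i, x) at h1
  change ∀ i : {i // i ∉ J}, f (fun i => S i, (S i).1) = g (fun i => S i, (S i).1) at h2
  have hmeas : AEMeasurable (fun x => f (fun i => S i, x)) D.fst :=
    ⟨_, hgm.comp (by fun_prop), h1⟩
  change ¬ _ at hS
  rw [not_and] at hS
  have h3 := hS hmeas
  rw [not_le, listErr_congr h1] at h3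
  change ∑ i : {i // i ∉ J}, listLoss (g (fun i => S i, (S i).1)) (S i).2 + (n - J.card : ℝ) * t
      ≤ (n - J.card : ℝ) * listErr D (fun x => g (fun i => S i, x))
  simp only [← h2]
  exact h3.le

end Generalization

/-! ### Measurability of reconstructed hypotheses -/

section Measurability

/-- The restriction of a sample to `J`, extended by a default point. -/
def extend {X : Type*} {n : ℕ} {J : Finset (Fin n)} (x₀ : X) (y : {i // i ∈ J} → X × I) :
    Fin n → X :=
  fun i => if h : i ∈ J then (y ⟨i, h⟩).1 else x₀

theorem recon_extend {X : Type*} {H : Set (X → I)} {γ : ℝ} {n N T k B : ℕ}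
    (θ : Fin T → Desc n N (gridSize γ)) {J : Finset (Fin n)} (hJ : ∀ t i, (θ t).1 i ∈ J)
    (x₀ : X) (S : Fin n → X × I) (x : X) :
    recon H γ k B θ (extend x₀ fun i : {i // i ∈ J} => S i) x
      = recon H γ k B θ (fun i => (S i).1) x := by
  have : ∀ t, (extend x₀ fun i : {i // i ∈ J} => S i) ∘ (θ t).1 = (fun i => (S i).1) ∘ (θ t).1 := by
    intro t
    funext i
    simp [extend, hJ t i]
  simp only [recon, this]

variable {X : Type*} [MeasurableSpace X] {H : Set (X → I)} {D : Measure (X × I)}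
  [IsProbabilityMeasure D]

theorem IsMeasurableClass.nullMeasurableSet (hH : IsMeasurableClass H D) {ι : Type*} [Fintype ι]
    {U : Set (ι → I)} (hU : IsOpen U) :
    NullMeasurableSet {z : ι → X | ∃ h ∈ H, (fun i => h (z i)) ∈ U}
      (Measure.pi fun _ => D.fst) := by
  let e := Fintype.equivFin ι
  have hmp := measurePreserving_piCongrLeft (fun _ : Fin (Fintype.card ι) => D.fst) e
  have h := (hH.2 (Fintype.card ι) {v | (fun i => v (e i)) ∈ U}
    (hU.preimage (by fun_prop))).preimage hmp.quasiMeasurePreserving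
  convert h using 1
  ext z
  have hz : ∀ i, MeasurableEquiv.piCongrLeft (fun _ => X) e z (e i) = z i := fun i =>
    Equiv.piCongrLeft_apply_apply (fun _ => X) e z i
  simp only [Set.mem_ofPred_eq, Set.mem_preimage, hz]

theorem measurePreserving_option {ι Y : Type*} [Fintype ι] [MeasurableSpace Y] (ν : Measure Y)
    [SigmaFinite ν] :
    MeasurePreserving (fun (q : (ι → Y) × Y) (o : Option ι) => o.elim q.2 q.1)
      ((Measure.pi fun _ => ν).prod ν) (Measure.pi fun _ => ν) := by
  have hm : Measurable fun (q : (ι → Y) × Y) (o : Option ι) => o.elim q.2 q.1 := by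
    rw [measurable_pi_iff]
    rintro (_ | i)
    · exact measurable_snd
    · exact (measurable_pi_apply i).comp measurable_fst
  refine ⟨hm, (Measure.pi_eq fun s hs => ?_).symm⟩
  rw [Measure.map_apply hm (MeasurableSet.univ_pi hs)]
  have : (fun (q : (ι → Y) × Y) (o : Option ι) => o.elim q.2 q.1) ⁻¹' Set.univ.pi s
      = (Set.univ.pi fun i => s (some i)) ×ˢ s none := by
    ext q
    simp only [Set.mem_preimage, Set.mem_univ_pi, Set.mem_prod, Option.forall, Option.elim_none,
      Option.elim_some]
    exact and_comm
  rw [this, Measure.prod_prod, Measure.pi_pi, Fintype.prod_option, mul_comm]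

theorem aemeasurable_mem_of_nullMeasurableSet {Y : Type*} [MeasurableSpace Y] {ν : Measure Y}
    {s : Set Y} (hs : NullMeasurableSet s ν) : AEMeasurable (fun y => y ∈ s) ν := by
  obtain ⟨t, ht, hst⟩ := hs
  exact ⟨fun y => y ∈ t, measurableSet_setOfPred.1 ht, hst⟩

/-- The points enter only through a finite tuple of sets of patterns. Membership of a given pattern
says that some h in `H` sends the points into an open box, which the measurability convention
covers; the test point is the extra coordinate `none`. -/
theorem aemeasurable_recon (hH : IsMeasurableClass H D) {γ : ℝ} {n N T k B : ℕ}
    (θ : Fin T → Desc n N (gridSize γ)) {J : Finset (Fin n)} (hJ : ∀ t i, (θ t).1 i ∈ J)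
    (x₀ : X) :
    AEMeasurable (fun q : ({i // i ∈ J} → X × I) × X => recon H γ k B θ (extend x₀ q.1) q.2)
      ((Measure.pi fun _ : {i // i ∈ J} => D).prod D.fst) := by
  let Ψ : (Fin T → Set (Fin N → Fin (gridSize γ))) → Fin k → I := fun F =>
    toList γ k (gridList k B θ F)
  have hΨ : Measurable Ψ := measurable_of_finite Ψ
  refine hΨ.comp_aemeasurable (aemeasurable_pi_iff.2 fun t => ?_)
  refine aemeasurable_pi_iff.2 fun p => ?_
  have h1 : MeasurePreserving (fun (y : {i // i ∈ J} → X × I) i => (y i).1)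
      (Measure.pi fun _ => D) (Measure.pi fun _ => D.fst) :=
    measurePreserving_pi _ _ fun _ => MeasurePreserving.mk measurable_fst rfl
  have h2 := (measurePreserving_option (ι := {i // i ∈ J}) D.fst).comp
    (h1.prod (MeasurePreserving.id D.fst))
  let π : Fin N → Option {i // i ∈ J} := fun i =>
    if i = (θ t).2.2.1 then none else some ⟨(θ t).1 i, hJ t i⟩
  have hU : IsOpen {v : Option {i // i ∈ J} → I | ∀ i, v (π i) ∈ bin γ (p i)} := by
    rw [Set.ofPred_forall]
    exact isOpen_iInter_of_finite fun i => (isOpen_bin γ _).preimage (by fun_prop)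
  have h3 := aemeasurable_mem_of_nullMeasurableSet
    ((hH.nullMeasurableSet hU).preimage h2.quasiMeasurePreserving)
  refine h3.congr (Filter.Eventually.of_forall fun q => ?_)
  have hz : ∀ i, ((π i).elim q.2 fun i => (q.1 i).1)
      = Function.update (extend x₀ q.1 ∘ (θ t).1) (θ t).2.2.1 q.2 i := by
    intro i
    simp only [π, Function.update_apply]
    split_ifs with h
    · rfl
    · simp [extend, hJ t i]
  refine propext (exists_congr fun h => and_congr_right fun _ => forall_congr' fun i => ?_)
  change h ((π i).elim q.2 fun i => (q.1 i).1) ∈ _ ↔ _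
  rw [hz]

end Measurability

/-! ### Empirical risk minimization over descriptions -/

section Learner

variable {X : Type*} [MeasurableSpace X] {H : Set (X → I)}

/-- The indices of the sample points used by `θ`. -/
def usedIndices {n N L T : ℕ} (θ : Fin T → Desc n N L) : Finset (Fin n) :=
  Finset.univ.image fun q : Fin T × Fin N => (θ q.1).1 q.2

theorem card_usedIndices_le {n N L T : ℕ} (θ : Fin T → Desc n N L) :
    (usedIndices θ).card ≤ T * N :=
  Finset.card_image_le.trans (by simp)

theorem mem_usedIndices {n N L T : ℕ} (θ : Fin T → Desc n N L) (t : Fin T) (i : Fin N) :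
    (θ t).1 i ∈ usedIndices θ :=
  Finset.mem_image.2 ⟨(t, i), Finset.mem_univ _, rfl⟩

/-- The empirical loss on a hypothesis exceeds its error by `t` only with small probability. -/
theorem measure_empirical_ge_le {n : ℕ} (D : Measure (X × I)) [IsProbabilityMeasure D]
    {h : X → I} (hm : AEMeasurable h D.fst) {t : ℝ} (ht : 0 ≤ t) :
    (Measure.pi fun _ : Fin n => D)
      {S | n * hypErr D h + n * t ≤ ∑ i, listLoss (fun _ : Fin 1 => h (S i).1) (S i).2}
      ≤ ENNReal.ofReal (Real.exp (-2 * n * t ^ 2)) := by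
  have hm' : AEMeasurable (fun x (_ : Fin 1) => h x) D.fst := aemeasurable_pi_iff.2 fun _ => hm
  -- The other tail follows by replacing the loss by one minus the loss.
  have key := measure_sum_le_le (ι := Fin n) D
    (g := fun z : X × I => 1 - listLoss (fun _ : Fin 1 => h z.1) z.2)
    ((aemeasurable_listLoss hm').const_sub 1)
    (fun z => ⟨by linarith [listLoss_le_one (fun _ : Fin 1 => h z.1) z.2],
      by linarith [listLoss_nonneg (fun _ : Fin 1 => h z.1) z.2]⟩) ht
  rw [Fintype.card_fin] at key
  refine le_trans (measure_mono fun S hS => ?_) key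
  have hmean : ∫ z : X × I, (1 - listLoss (fun _ : Fin 1 => h z.1) z.2) ∂D = 1 - hypErr D h := by
    rw [integral_sub (integrable_const _) (integrable_listLoss hm')]
    simp [hypErr, listErr]
  have hS' : n * hypErr D h + n * t ≤ ∑ i, listLoss (fun _ : Fin 1 => h (S i).1) (S i).2 := hS
  rw [Set.mem_ofPred_eq, hmean, Finset.sum_sub_distrib]
  simp only [Finset.sum_const, Finset.card_univ, Fintype.card_fin, nsmul_eq_mul, mul_one]
  linarith

/-- Empirical risk minimization over all reconstructed list hypotheses. -/
theorem exists_erm {γ : ℝ} {n N T k r s : ℕ} (hne : H.Nonempty) (hγ : 0 < γ) (hk : 1 ≤ k)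
    (hn : 0 < n) (hN : 0 < N) (hfin : fatDim H (γ / 2) k ≠ ⊤)
    (hr : (N * gridSize γ ^ (k + 1) + 1) ^ (fatDim H (γ / 2) k).toNat * k ^ r < (k + 1) ^ r)
    (hs : 2 * (s / N + ((N * gridSize γ + 1) ^ r : ℕ) / 2 ^ s) ≤ 1 / (4 * (k + 1 : ℝ)))
    (hT : 4 * (k + 1) * (Real.log n + 1) ≤ T) (hTN : 2 * (T * N) ≤ n) :
    ∃ a : (Fin n → X × I) → X → Fin k → I, ∀ D : Measure (X × I), IsProbabilityMeasure D →
      IsMeasurableClass H D → ∀ t : ℝ, 0 < t →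
        (Measure.pi fun _ : Fin n => D)
          {S | ¬ (AEMeasurable (a S) D.fst ∧
            listErr D (a S) ≤ (⨅ h : H, hypErr D h.1) + (5 * γ + T * N / n + 3 * t))}
        ≤ ENNReal.ofReal ((Fintype.card (Fin T → Desc n N (gridSize γ)) + 1) *
            Real.exp (-n * t ^ 2)) := by
  classical
  set B := (N * gridSize γ + 1) ^ r
  let Θ := Fin T → Desc n N (gridSize γ)
  have hΘ : Nonempty Θ :=
    ⟨fun _ => (fun _ => ⟨0, hn⟩, ∅, ⟨0, hN⟩, fun _ => ⟨0, by simp [gridSize]⟩)⟩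
  let f : Θ → (Fin n → X × I) → X → Fin k → I := fun θ S => recon H γ k B θ fun i => (S i).1
  let emp : Θ → (Fin n → X × I) → ℝ := fun θ S => ∑ i, listLoss (f θ S (S i).1) (S i).2
  -- The minimizer need not be measurable in the sample: its failures are covered by the finite
  -- union of the failures of all descriptions.
  choose θm hθm using fun S : Fin n → X × I => Finite.exists_min fun θ : Θ => emp θ S
  refine ⟨fun S => f (θm S) S, fun D hD hH t ht => ?_⟩
  have : Nonempty H := hne.to_subtype
  have hX : Nonempty (X × I) := nonempty_of_isProbabilityMeasure D
  obtain ⟨z₀⟩ := hX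
  -- The comparison hypothesis is fixed before the sample is drawn, so its empirical loss needs only
  -- one application of Hoeffding. The three terms t pay for its distance to the infimum, its
  -- deviation and the generalization of the minimizer.
  obtain ⟨⟨h, hh⟩, hlt⟩ := exists_lt_of_ciInf_lt
    (show (⨅ h : H, hypErr D h.1) < (⨅ h : H, hypErr D h.1) + t by linarith)
  have hn' : (0 : ℝ) < n := by exact_mod_cast hn
  let badθ : Θ → Set (Fin n → X × I) := fun θ =>
    {S | ¬ (AEMeasurable (f θ S) D.fst ∧
      (n - (usedIndices θ).card : ℝ) * listErr D (f θ S) ≤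
        (∑ i : {i // i ∉ usedIndices θ}, listLoss (f θ S (S i).1) (S i).2)
          + (n - (usedIndices θ).card : ℝ) * t)}
  have hcard : ∀ θ : Θ, (2 * (usedIndices θ).card : ℝ) ≤ n := by
    intro θ
    exact_mod_cast (Nat.mul_le_mul_left 2 (card_usedIndices_le θ)).trans hTN
  have hbadθ : ∀ θ, (Measure.pi fun _ : Fin n => D) (badθ θ)
      ≤ ENNReal.ofReal (Real.exp (-n * t ^ 2)) := by
    intro θ
    have key := measure_generalization_le D (usedIndices θ)
      (fun q => recon H γ k B θ (extend z₀.1 q.1) q.2)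
      (aemeasurable_recon hH θ (mem_usedIndices θ) z₀.1) ht.le
    simp only [recon_extend θ (mem_usedIndices θ)] at key
    refine key.trans (ENNReal.ofReal_le_ofReal (Real.exp_le_exp.2 ?_))
    -- At least half of the sample is unused, which halves the exponent at worst.
    nlinarith [hcard θ, sq_nonneg t]
  let badh : Set (Fin n → X × I) :=
    {S | n * hypErr D h + n * t ≤ ∑ i, listLoss (fun _ : Fin 1 => h (S i).1) (S i).2}
  have hbadh : (Measure.pi fun _ : Fin n => D) badh ≤ ENNReal.ofReal (Real.exp (-n * t ^ 2)) := by
    refine (measure_empirical_ge_le D (hH.1 h hh) ht.le).trans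
      (ENNReal.ofReal_le_ofReal (Real.exp_le_exp.2 ?_))
    nlinarith [sq_nonneg t]
  have hsub : {S | ¬ (AEMeasurable (f (θm S) S) D.fst ∧ listErr D (f (θm S) S) ≤
      (⨅ h : H, hypErr D h.1) + (5 * γ + T * N / n + 3 * t))} ⊆ (⋃ θ, badθ θ) ∪ badh := by
    intro S hS
    by_contra hcon
    rw [Set.mem_union, not_or, Set.mem_iUnion, not_exists] at hcon
    obtain ⟨h1, h2⟩ := hcon
    have h1 := not_not.1 (h1 (θm S))
    have h2 : ∑ i, listLoss (fun _ : Fin 1 => h (S i).1) (S i).2 < n * hypErr D h + n * t :=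
      not_le.1 h2
    apply hS
    refine ⟨h1.1, ?_⟩
    obtain ⟨θ, hθ⟩ := exists_recon_near hγ hk hn hN hfin hr hs hT (fun i => (S i).1) hh
    have h3 : emp θ S ≤ ∑ i, listLoss (fun _ : Fin 1 => h (S i).1) (S i).2 + n * (5 * γ) := by
      have : ∀ i, listLoss (f θ S (S i).1) (S i).2
          ≤ listLoss (fun _ : Fin 1 => h (S i).1) (S i).2 + 5 * γ := by
        intro i
        obtain ⟨j, hj⟩ := hθ i
        exact listLoss_le_add hj _
      refine (Finset.sum_le_sum fun i _ => this i).trans ?_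
      rw [Finset.sum_add_distrib]
      simp
    have h4 : (∑ i : {i // i ∉ usedIndices (θm S)}, listLoss (f (θm S) S (S i).1) (S i).2)
        ≤ emp (θm S) S := by
      rw [← Finset.sum_subtype (usedIndices (θm S))ᶜ (fun i => Finset.mem_compl)
        fun i => listLoss (f (θm S) S (S i).1) (S i).2]
      exact Finset.sum_le_sum_of_subset_of_nonneg (Finset.subset_univ _)
        fun i _ _ => listLoss_nonneg _ _
    have h5 := h1.2
    have h6 := hθm S θ
    have h7 : ((usedIndices (θm S)).card : ℝ) ≤ T * N := by
      exact_mod_cast card_usedIndices_le (θm S)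
    have h8 := listErr_le_one D (f (θm S) S)
    have h9 := listErr_nonneg D (f (θm S) S)
    have h10 : (0 : ℝ) ≤ (usedIndices (θm S)).card := Nat.cast_nonneg _
    -- Each used point costs at most 1, together at most TN.
    have h11 : n * listErr D (f (θm S) S)
        ≤ n * (hypErr D h + t + (5 * γ) + t) + T * N := by
      nlinarith
    have h12 : listErr D (f (θm S) S) ≤ hypErr D h + t + (5 * γ) + t + T * N / n := by
      have e : n * (hypErr D h + t + (5 * γ) + t + T * N / n)
          = n * (hypErr D h + t + (5 * γ) + t) + T * N := by
        field_simp
      exact le_of_mul_le_mul_left (h11.trans_eq e.symm) hn'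
    linarith
  refine (measure_mono hsub).trans ((measure_union_le _ _).trans ?_)
  rw [add_mul, one_mul, ENNReal.ofReal_add (by positivity) (by positivity)]
  refine add_le_add ((measure_iUnion_fintype_le _ _).trans ?_) hbadh
  refine (Finset.sum_le_sum fun θ _ => hbadθ θ).trans ?_
  rw [Finset.sum_const, nsmul_eq_mul, ENNReal.ofReal_mul (by positivity), ENNReal.ofReal_natCast,
    Finset.card_univ]

end Learner

/-! ### Choice of parameters -/

section Parameters

theorem exists_rounds {k d N L : ℕ} {Λ : ℝ} (hk : 1 ≤ k) (hd : 1 ≤ d) (hL : 1 ≤ L) (hN : 1 ≤ N)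
    (hΛ : 1 ≤ Λ) (hlL : Real.log L ≤ 2 * Λ) (hlk : Real.log k ≤ Λ - 1) (hlN : Real.log N ≤ Λ)
    (hNge : 3680 * (k : ℝ) ^ 3 * d * Λ ^ 2 ≤ N) :
    ∃ r s : ℕ, (N * L ^ (k + 1) + 1) ^ d * k ^ r < (k + 1) ^ r ∧
      2 * (s / N + ((N * L + 1) ^ r : ℕ) / 2 ^ s) ≤ 1 / (4 * (k + 1 : ℝ)) := by
  have hk' : (1 : ℝ) ≤ k := by exact_mod_cast hk
  have hd' : (1 : ℝ) ≤ d := by exact_mod_cast hd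
  have hL' : (1 : ℝ) ≤ L := by exact_mod_cast hL
  have hN' : (1 : ℝ) ≤ N := by exact_mod_cast hN
  have hlog2 : Real.log 2 ≤ 1 := by linarith [Real.log_two_lt_d9]
  have hlog2' : 1 / 2 ≤ Real.log 2 := by linarith [Real.log_two_gt_d9]
  have hkd : 1 ≤ (k : ℝ) ^ 2 * d := one_le_mul_of_one_le_of_one_le (one_le_pow₀ hk') hd'
  have hkdΛ : 1 ≤ (k : ℝ) ^ 2 * d * Λ := one_le_mul_of_one_le_of_one_le hkd hΛ
  have hΛ2 : Λ ≤ (k : ℝ) ^ 2 * d * Λ ^ 2 := by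
    have : 1 * Λ ≤ (k : ℝ) ^ 2 * d * Λ * Λ := mul_le_mul_of_nonneg_right hkdΛ (by linarith)
    linarith
  -- Since log(1 + 1/k) ≥ 1/(k+1), this makes ((k+1)/k)^r exceed the Sauer-type bound, whose
  -- logarithm is at most d · 6kΛ.
  set r := ⌊(k + 1 : ℝ) * d * (6 * k * Λ)⌋₊ + 1 with hr
  have hrgt : (k + 1 : ℝ) * d * (6 * k * Λ) < r := by
    rw [hr]; push_cast; exact Nat.lt_floor_add_one _
  have hrle : (r : ℝ) ≤ 13 * (k ^ 2 * d * Λ) := by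
    have h1 : (r : ℝ) ≤ (k + 1 : ℝ) * d * (6 * k * Λ) + 1 := by
      rw [hr]; push_cast
      gcongr
      exact Nat.floor_le (by positivity)
    have h2 : (k + 1 : ℝ) * d * (6 * k * Λ) ≤ (2 * k) * d * (6 * k * Λ) := by
      gcongr; linarith
    nlinarith
  -- Chosen so that 2^s is at least 16(k+1) times the cover size. The constant 3680 = 115 · 32 in
  -- the lower bound on `N` then gives s/N ≤ 1/(16(k+1)).
  set s := ⌈2 * (5 * Λ + 52 * (k ^ 2 * d * Λ ^ 2) : ℝ)⌉₊ with hs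
  have hsge : 2 * (5 * Λ + 52 * (k ^ 2 * d * Λ ^ 2) : ℝ) ≤ s := Nat.le_ceil _
  have hsle : (s : ℝ) ≤ 115 * (k ^ 2 * d * Λ ^ 2) := by
    have := (Nat.ceil_lt_add_one (a := 2 * (5 * Λ + 52 * (k ^ 2 * d * Λ ^ 2) : ℝ))
      (by positivity)).le
    rw [← hs] at this
    linarith
  refine ⟨r, s, ?_, ?_⟩
  · have hA : Real.log (N * L ^ (k + 1) + 1) ≤ 6 * k * Λ := by
      have h1 : (1 : ℝ) ≤ N * L ^ (k + 1) :=
        one_le_mul_of_one_le_of_one_le hN' (one_le_pow₀ hL')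
      calc Real.log (N * L ^ (k + 1) + 1) ≤ Real.log (2 * (N * L ^ (k + 1))) :=
            Real.log_le_log (by positivity) (by linarith)
        _ = Real.log 2 + (Real.log N + (k + 1) * Real.log L) := by
            rw [Real.log_mul (by norm_num) (by positivity), Real.log_mul (by positivity)
              (by positivity), Real.log_pow]
            push_cast
            ring
        _ ≤ Λ + (Λ + (k + 1) * (2 * Λ)) := by gcongr; linarith
        _ ≤ _ := by nlinarith
    have hB : 1 / (k + 1 : ℝ) ≤ Real.log (k + 1) - Real.log k := by
      have h1 := Real.log_le_sub_one_of_pos (x := (k : ℝ) / (k + 1)) (by positivity)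
      rw [Real.log_div (by positivity) (by positivity)] at h1
      have h2 : (k : ℝ) / (k + 1) - 1 = -(1 / (k + 1)) := by field_simp; ring
      linarith
    have hC : (d : ℝ) * Real.log (N * L ^ (k + 1) + 1) + r * Real.log k
        < r * Real.log (k + 1) := by
      have h1 : (d : ℝ) * Real.log (N * L ^ (k + 1) + 1) ≤ d * (6 * k * Λ) := by gcongr
      have h2 : (d : ℝ) * (6 * k * Λ) < r * (1 / (k + 1)) := by
        rw [mul_one_div, lt_div_iff₀ (by positivity)]
        linarith
      have h3 : (r : ℝ) * (1 / (k + 1)) ≤ r * (Real.log (k + 1) - Real.log k) := by gcongr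
      linarith
    have hD : ((N * L ^ (k + 1) + 1 : ℝ)) ^ d * (k : ℝ) ^ r < (k + 1 : ℝ) ^ r := by
      rw [← Real.log_lt_log_iff (by positivity) (by positivity), Real.log_mul (by positivity)
        (by positivity), Real.log_pow, Real.log_pow, Real.log_pow]
      exact hC
    exact_mod_cast hD
  · have hA : Real.log (N * L + 1) ≤ 4 * Λ := by
      have h1 : (1 : ℝ) ≤ N * L := one_le_mul_of_one_le_of_one_le hN' hL'
      calc Real.log (N * L + 1) ≤ Real.log (2 * (N * L)) :=
            Real.log_le_log (by positivity) (by linarith)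
        _ = Real.log 2 + (Real.log N + Real.log L) := by
            rw [Real.log_mul (by norm_num) (by positivity), Real.log_mul (by positivity)
              (by positivity)]
        _ ≤ Λ + (Λ + 2 * Λ) := by gcongr; linarith
        _ = _ := by ring
    have hB : (16 * (k + 1) : ℝ) * (N * L + 1) ^ r ≤ 2 ^ s := by
      rw [← Real.log_le_log_iff (by positivity) (by positivity), Real.log_mul (by positivity)
        (by positivity), Real.log_pow, Real.log_pow]
      have h1 : Real.log (16 * (k + 1)) ≤ 5 * Λ := by
        calc Real.log (16 * (k + 1)) ≤ Real.log (2 ^ 5 * k) :=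
              Real.log_le_log (by positivity) (by linarith)
          _ = 5 * Real.log 2 + Real.log k := by
              rw [Real.log_mul (by positivity) (by positivity), Real.log_pow]
              norm_num
          _ ≤ _ := by linarith
      have h2 : (r : ℝ) * Real.log (N * L + 1) ≤ 13 * (k ^ 2 * d * Λ) * (4 * Λ) :=
        mul_le_mul hrle hA (Real.log_nonneg (by nlinarith)) (by positivity)
      have h3 : (s : ℝ) * (1 / 2) ≤ s * Real.log 2 := by gcongr
      nlinarith
    have hC : ((N * L + 1) ^ r : ℕ) / (2 : ℝ) ^ s ≤ 1 / (16 * (k + 1)) := by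
      rw [div_le_div_iff₀ (by positivity) (by positivity)]
      push_cast
      linarith
    have hD : (s : ℝ) / N ≤ 1 / (16 * (k + 1)) := by
      rw [div_le_div_iff₀ (by positivity) (by positivity)]
      have h1 : (s : ℝ) * (16 * (k + 1)) ≤ 115 * (k ^ 2 * d * Λ ^ 2) * (16 * (2 * k)) := by
        gcongr; linarith
      nlinarith
    have e : 2 * (1 / (16 * (k + 1)) + 1 / (16 * (k + 1))) = 1 / (4 * (k + 1 : ℝ)) := by
      field_simp; norm_num
    linarith

theorem one_le_gridSize (γ : ℝ) : 1 ≤ gridSize γ := by simp [gridSize]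

theorem log_gridSize_le {γ : ℝ} (hγ : 0 < γ) (hγ1 : γ < 1) :
    Real.log (gridSize γ) ≤ 2 + Real.log (1 / γ) := by
  have h1 : 1 ≤ 1 / γ := by rw [le_div_iff₀ hγ]; linarith
  have h2 : (gridSize γ : ℝ) ≤ 3 * (1 / γ) := by
    have := (Nat.ceil_lt_add_one (one_div_pos.2 hγ).le).le
    unfold gridSize
    push_cast
    linarith
  have h0 : (1 : ℝ) ≤ gridSize γ := by exact_mod_cast one_le_gridSize γ
  calc Real.log (gridSize γ) ≤ Real.log (3 * (1 / γ)) := Real.log_le_log (by linarith) h2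
    _ = Real.log 3 + Real.log (1 / γ) := Real.log_mul (by norm_num) (by positivity)
    _ ≤ _ := by
      have := Real.log_le_sub_one_of_pos (x := 3) (by norm_num)
      linarith

theorem log_card_desc_le {n N L T : ℕ} {Λ : ℝ} (hn : 1 ≤ n) (hN : 1 ≤ N) (hL : 1 ≤ L)
    (hT : 1 ≤ T) (hΛ : 1 ≤ Λ) (hln : Real.log n ≤ Λ) (hlN : Real.log N ≤ Λ)
    (hlL : Real.log L ≤ 2 * Λ) :
    Real.log (Fintype.card (Fin T → Desc n N L) + 1) ≤ 6 * (T * N * Λ) := by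
  have hT' : (1 : ℝ) ≤ T := by exact_mod_cast hT
  have hN' : (1 : ℝ) ≤ N := by exact_mod_cast hN
  have hlog2 : Real.log 2 ≤ 1 := by linarith [Real.log_two_lt_d9]
  have hn0 : (0 : ℝ) < n := by exact_mod_cast hn
  have hL0 : (0 : ℝ) < L := by exact_mod_cast hL
  have hcard : (Fintype.card (Fin T → Desc n N L) : ℝ)
      = ((n : ℝ) ^ N * (2 ^ N * (N * L ^ N))) ^ T := by
    simp [Desc]
  have h1 : (1 : ℝ) ≤ Fintype.card (Fin T → Desc n N L) := by
    have : 0 < Fintype.card (Fin T → Desc n N L) := by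
      rw [← Nat.cast_pos (α := ℝ), hcard]
      positivity
    exact_mod_cast this
  have hTN : 1 ≤ (T : ℝ) * N := one_le_mul_of_one_le_of_one_le hT' hN'
  calc Real.log (Fintype.card (Fin T → Desc n N L) + 1)
      ≤ Real.log (2 * Fintype.card (Fin T → Desc n N L)) :=
        Real.log_le_log (by positivity) (by linarith)
    _ = Real.log 2 + T * (N * Real.log n + (N * Real.log 2 + (Real.log N + N * Real.log L))) := by
        rw [Real.log_mul (by norm_num) (by linarith), hcard, Real.log_pow, Real.log_mul
          (by positivity) (by positivity), Real.log_mul (by positivity) (by positivity),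
          Real.log_mul (by positivity) (by positivity), Real.log_pow, Real.log_pow, Real.log_pow]
    _ ≤ Λ + T * (N * Λ + (N * Λ + (N * Λ + N * (2 * Λ)))) := by
        gcongr
        · linarith
        · linarith
        · nlinarith
    _ ≤ _ := by nlinarith

end Parameters

/-! ### The learner at a fixed scale of positive dimension -/

section Core

variable {X : Type*} [MeasurableSpace X] {H : Set (X → I)}

/-- The logarithmic factor of the bounds. -/
def logFactor (n k : ℕ) (γ : ℝ) : ℝ := 1 + Real.log (n * k / γ)

/-- Agnostic list learning at a fixed scale, for a fixed sample size. -/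
theorem exists_learner_at_scale {γ : ℝ} {n k : ℕ} (hne : H.Nonempty) (hγ : 0 < γ) (hγ1 : γ < 1)
    (hk : 1 ≤ k) (hn : 1 ≤ n) (hfin : fatDim H (γ / 2) k ≠ ⊤)
    (hd : 1 ≤ (fatDim H (γ / 2) k).toNat) :
    ∃ a : (Fin n → X × I) → X → Fin k → I, ∀ D : Measure (X × I), IsProbabilityMeasure D →
      IsMeasurableClass H D → ∀ δ : ℝ, 0 < δ → δ < 1 →
        (Measure.pi fun _ : Fin n => D)
          {S | ¬ (AEMeasurable (a S) D.fst ∧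
            listErr D (a S) ≤ (⨅ h : H, hypErr D h.1) + (5 * γ + 2000 * Real.sqrt
              (((k : ℝ) ^ 8 * (fatDim H (γ / 2) k).toNat * logFactor n k γ ^ 4
                + Real.log (1 / δ)) / n)))}
        ≤ ENNReal.ofReal δ := by
  set d := (fatDim H (γ / 2) k).toNat with hd_def
  set Λ := logFactor n k γ with hΛ_def
  have hk' : (1 : ℝ) ≤ k := by exact_mod_cast hk
  have hd' : (1 : ℝ) ≤ d := by exact_mod_cast hd
  have hn' : (1 : ℝ) ≤ n := by exact_mod_cast hn
  have hγ' : 1 ≤ 1 / γ := by rw [le_div_iff₀ hγ]; linarith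
  have hΛeq : Λ = 1 + (Real.log n + Real.log k + Real.log (1 / γ)) := by
    rw [hΛ_def, logFactor, div_eq_mul_one_div, Real.log_mul (by positivity) (by positivity),
      Real.log_mul (by positivity) (by positivity)]
  have hln := Real.log_nonneg hn'
  have hlk := Real.log_nonneg hk'
  have hlγ := Real.log_nonneg hγ'
  have hΛ : 1 ≤ Λ := by linarith
  have hlL : Real.log (gridSize γ) ≤ 2 * Λ := by linarith [log_gridSize_le hγ hγ1]
  have hpow : (1 : ℝ) ≤ k ^ 3 * d * Λ ^ 2 := one_le_mul_of_one_le_of_one_le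
    (one_le_mul_of_one_le_of_one_le (one_le_pow₀ hk') hd') (one_le_pow₀ hΛ)
  set N := ⌈3680 * (k : ℝ) ^ 3 * d * Λ ^ 2⌉₊ with hN_def
  set T := ⌈8 * (k : ℝ) * Λ⌉₊ with hT_def
  have hNge : 3680 * (k : ℝ) ^ 3 * d * Λ ^ 2 ≤ N := Nat.le_ceil _
  have hNle : (N : ℝ) ≤ 3681 * (k ^ 3 * d * Λ ^ 2) := by
    have := (Nat.ceil_lt_add_one (a := 3680 * (k : ℝ) ^ 3 * d * Λ ^ 2) (by positivity)).le
    rw [← hN_def] at this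
    linarith
  have hTge : 8 * (k : ℝ) * Λ ≤ T := Nat.le_ceil _
  have hkΛ : 1 ≤ (k : ℝ) * Λ := one_le_mul_of_one_le_of_one_le hk' hΛ
  have hTle : (T : ℝ) ≤ 9 * (k * Λ) := by
    have := (Nat.ceil_lt_add_one (a := 8 * (k : ℝ) * Λ) (by positivity)).le
    rw [← hT_def] at this
    linarith
  have hN1 : 1 ≤ N := by
    have : (1 : ℝ) ≤ N := by linarith
    exact_mod_cast this
  have hT1 : 1 ≤ T := by
    have : (1 : ℝ) ≤ T := by linarith
    exact_mod_cast this
  set Q : ℝ := (k : ℝ) ^ 8 * d * Λ ^ 4 with hQ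
  -- The argument yields the fourth power of k; the eighth is slack.
  have hTNΛ : (T : ℝ) * N * Λ ≤ 33129 * Q := by
    calc (T : ℝ) * N * Λ ≤ (9 * (k * Λ)) * (3681 * (k ^ 3 * d * Λ ^ 2)) * Λ := by gcongr
      _ = 33129 * ((k : ℝ) ^ 4 * d * Λ ^ 4) := by ring
      _ ≤ 33129 * ((k : ℝ) ^ 8 * d * Λ ^ 4) := by
        gcongr
        norm_num
  have hTNQ : (T : ℝ) * N ≤ 33129 * Q := by
    refine le_trans ?_ hTNΛ
    exact le_mul_of_one_le_right (by positivity) hΛ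
  have hQ0 : 0 ≤ Q := by positivity
  have hn0 : (0 : ℝ) < n := by linarith
  -- If n < 2TN, the claimed radius exceeds 1 and any output will do.
  by_cases hcase : 2 * (T * N) ≤ n
  · have hNn : (N : ℝ) ≤ n := by
      have : N ≤ T * N := Nat.le_mul_of_pos_left _ hT1
      exact_mod_cast (by omega : N ≤ n)
    have hN0 : (0 : ℝ) < N := by exact_mod_cast hN1
    have hlN : Real.log N ≤ Λ := by linarith [Real.log_le_log hN0 hNn]
    obtain ⟨r, s, hr, hs⟩ := exists_rounds hk hd (one_le_gridSize γ) hN1 hΛ hlL (by linarith) hlN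
      hNge
    obtain ⟨a, ha⟩ := exists_erm (X := X) (T := T) hne hγ hk hn hN1 hfin hr hs
      (by
        refine le_trans ?_ hTge
        have h1 : Real.log n + 1 ≤ Λ := by linarith
        calc 4 * ((k : ℝ) + 1) * (Real.log n + 1) ≤ 4 * (k + k) * Λ := by gcongr
          _ = _ := by ring) hcase
    refine ⟨a, fun D hD hH δ hδ hδ1 => ?_⟩
    have hlδ : 0 < Real.log (1 / δ) := Real.log_pos (by rw [lt_div_iff₀ hδ]; linarith)
    -- The multiple 200000 of Q absorbs the logarithm of the number of descriptions, at most 6 ·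
    -- 33129 Q.
    set t := Real.sqrt ((200000 * Q + Real.log (1 / δ)) / n) with ht
    have ht0 : 0 < t := Real.sqrt_pos.2 (by positivity)
    have htsq : n * t ^ 2 = 200000 * Q + Real.log (1 / δ) := by
      rw [ht, Real.sq_sqrt (by positivity)]
      field_simp
    have h1 := ha D hD hH t ht0
    have hrad : 5 * γ + T * N / n + 3 * t
        ≤ 5 * γ + 2000 * Real.sqrt ((Q + Real.log (1 / δ)) / n) := by
      have h2 : (T : ℝ) * N / n ≤ t := by
        have hle1 : (T : ℝ) * N / n ≤ 1 := by
          rw [div_le_one hn0]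
          exact_mod_cast (by omega : T * N ≤ n)
        refine Real.le_sqrt_of_sq_le ?_
        calc ((T : ℝ) * N / n) ^ 2 ≤ T * N / n := by
              rw [sq]
              exact mul_le_of_le_one_left (by positivity) hle1
          _ ≤ _ := by gcongr; linarith
      have h3 : t ≤ 500 * Real.sqrt ((Q + Real.log (1 / δ)) / n) := by
        rw [ht]
        calc _ ≤ Real.sqrt (500 ^ 2 * ((Q + Real.log (1 / δ)) / n)) := by
              apply Real.sqrt_le_sqrt
              rw [← mul_div_assoc]
              gcongr
              linarith
          _ = _ := by
              rw [Real.sqrt_mul (by positivity), Real.sqrt_sq (by norm_num)]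
      linarith
    refine le_trans (measure_mono fun S hS => ?_) (h1.trans ?_)
    · rw [Set.mem_ofPred_eq] at hS ⊢
      intro hgood
      exact hS ⟨hgood.1, by linarith [hgood.2]⟩
    · refine ENNReal.ofReal_le_ofReal ?_
      have h4 := log_card_desc_le hn hN1 (one_le_gridSize γ) hT1 hΛ (by linarith) hlN hlL
      rw [← Real.log_le_log_iff (by positivity) hδ, Real.log_mul (by positivity) (by positivity),
        Real.log_exp, neg_mul, htsq, one_div, Real.log_inv]
      linarith
  · refine ⟨fun _ _ _ => 0, fun D hD hH δ hδ hδ1 => ?_⟩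
    have hlδ : 0 < Real.log (1 / δ) := Real.log_pos (by rw [lt_div_iff₀ hδ]; linarith)
    have hlt : (n : ℝ) < 2 * (T * N) := by exact_mod_cast not_le.1 hcase
    have h1 : 1 ≤ 2000 * Real.sqrt ((Q + Real.log (1 / δ)) / n) := by
      have : 1 / 2000 ≤ Real.sqrt ((Q + Real.log (1 / δ)) / n) := by
        refine Real.le_sqrt_of_sq_le ?_
        rw [le_div_iff₀ hn0]
        linarith
      linarith
    have h2 : 0 ≤ ⨅ h : H, hypErr D h.1 := Real.iInf_nonneg fun h => listErr_nonneg D _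
    have hempty : {S : Fin n → X × I | ¬ (AEMeasurable (fun (_ : X) (_ : Fin k) => (0 : I)) D.fst ∧
        listErr D (fun (_ : X) (_ : Fin k) => (0 : I)) ≤ (⨅ h : H, hypErr D h.1) +
          (5 * γ + 2000 * Real.sqrt ((Q + Real.log (1 / δ)) / n)))} = ∅ := by
      ext S
      simp only [Set.mem_ofPred_eq, Set.mem_empty_iff_false, iff_false, not_not]
      exact ⟨aemeasurable_const, by linarith [listErr_le_one D fun (_ : X) (_ : Fin k) => (0 : I)]⟩
    rw [hempty]
    simp

end Core

/-! ### Dimension zero: a list independent of the sample -/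

section Deterministic

variable {X : Type*} {H : Set (X → I)}

theorem FatShatters.anti {γ γ' : ℝ} {k d : ℕ} {x : Fin d → X} (hγ : γ' ≤ γ)
    (h : FatShatters H γ k x) : FatShatters H γ' k x := by
  obtain ⟨c, hc, hb⟩ := h
  refine ⟨c, fun i j j' hj => by linarith [hc i j j' hj], fun b => ?_⟩
  obtain ⟨f, hf, hfb⟩ := hb b
  exact ⟨f, hf, fun i j => ⟨fun h => by linarith [(hfb i j).1 h],
    fun h => by linarith [(hfb i j).2 h]⟩⟩

theorem fatDim_anti {γ γ' : ℝ} (hγ : γ' ≤ γ) (k : ℕ) : fatDim H γ k ≤ fatDim H γ' k :=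
  iSup₂_le fun d ⟨x, hx⟩ =>
    le_iSup₂_of_le (f := fun (d : ℕ) (_ : ∃ x : Fin d → X, FatShatters H γ' k x) => (d : ℕ∞))
      d ⟨x, hx.anti hγ⟩ le_rfl

/-- The points v j + γ serve as anchors and shatter the single point x. -/
theorem fatDim_ne_zero_of_chain {γ : ℝ} (hγ : 0 ≤ γ) {k : ℕ} {x : X} {v : ℕ → I}
    (hv : ∀ i ≤ k, ∃ h ∈ H, h x = v i) (hgap : ∀ i < k, (v i : ℝ) + 2 * γ ≤ v (i + 1)) :
    fatDim H γ k ≠ 0 := by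
  have hsh : FatShatters H γ k (fun _ : Fin 1 => x) := by
    refine ⟨fun _ j => ⟨v j + γ, ?_, ?_⟩, ?_, ?_⟩
    · linarith [(v j).2.1]
    · linarith [hgap j j.2, (v (j + 1)).2.2]
    · intro _ j j' hj
      have := hgap j j.2
      rw [← hj] at this
      simp only
      linarith
    · intro b
      obtain ⟨h, hh, hx⟩ := hv (b 0) (by omega)
      refine ⟨h, hh, fun i j => ?_⟩
      rw [Subsingleton.elim i 0, hx]
      constructor
      · intro hb
        have := hgap j j.2
        rw [hb]
        simp only
        linarith
      · intro hb
        rw [hb]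
        simp
  have hle : ((1 : ℕ) : ℕ∞) ≤ fatDim H γ k :=
    le_iSup₂_of_le (f := fun (d : ℕ) (_ : ∃ x : Fin d → X, FatShatters H γ k x) => (d : ℕ∞))
      1 ⟨_, hsh⟩ le_rfl
  intro h0
  rw [h0] at hle
  simp at hle

/-- The last elements of chains of `m + 1` values of `H` at `x` with gaps larger than `s`. -/
def chainEnds (H : Set (X → I)) (s : ℝ) (x : X) : ℕ → Set I
  | 0 => {u | ∃ h ∈ H, h x = u}
  | m + 1 => {u | (∃ h ∈ H, h x = u) ∧ ∃ w ∈ chainEnds H s x m, (w : ℝ) + s < u}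

theorem exists_chain {s : ℝ} {x : X} {m : ℕ} {u : I} (hu : u ∈ chainEnds H s x m) :
    ∃ v : ℕ → I, (∀ i ≤ m, ∃ h ∈ H, h x = v i) ∧ (∀ i < m, (v i : ℝ) + s < v (i + 1)) ∧
      v m = u := by
  induction m generalizing u with
  | zero => exact ⟨fun _ => u, fun _ _ => hu, fun i hi => absurd hi (by omega), rfl⟩
  | succ m ih =>
    obtain ⟨h1, w, hw, hlt⟩ := hu
    obtain ⟨v, hv, hgap, hvm⟩ := ih hw
    refine ⟨fun i => if i ≤ m then v i else u, fun i hi => ?_, fun i hi => ?_, by simp⟩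
    · by_cases him : i ≤ m
      · simpa [him] using hv i him
      · simpa [him] using h1
    · rcases Nat.lt_succ_iff_lt_or_eq.1 hi with h | rfl
      · simpa [h.le, Nat.succ_le_of_lt h] using hgap i h
      · simpa [hvm] using hlt

theorem chainEnds_eq_empty {γ : ℝ} (hγ : 0 ≤ γ) {k : ℕ} (h0 : fatDim H γ k = 0) (x : X) :
    chainEnds H (2 * γ) x k = ∅ := by
  by_contra hne
  obtain ⟨u, hu⟩ := Set.nonempty_iff_ne_empty.2 hne
  obtain ⟨v, hv, hgap, -⟩ := exists_chain hu
  exact fatDim_ne_zero_of_chain hγ hv (fun i hi => (hgap i hi).le) h0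

/-- Finitely many strict increases have a positive minimum, half of which is a scale of positive
dimension. -/
theorem chainEnds_zero_eq_empty {k : ℕ} (hk : 1 ≤ k) (h0 : ∀ γ : ℝ, 0 < γ → fatDim H γ k = 0)
    (x : X) : chainEnds H 0 x k = ∅ := by
  by_contra hne
  obtain ⟨u, hu⟩ := Set.nonempty_iff_ne_empty.2 hne
  obtain ⟨v, hv, hgap, -⟩ := exists_chain hu
  obtain ⟨i₀, hi₀, hmin⟩ := Finset.exists_min_image (Finset.range k)
    (fun i => (v (i + 1) : ℝ) - v i) ⟨0, Finset.mem_range.2 hk⟩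
  have hpos := hgap i₀ (Finset.mem_range.1 hi₀)
  refine fatDim_ne_zero_of_chain (γ := ((v (i₀ + 1) : ℝ) - v i₀) / 2) (by linarith) hv
    (fun i hi => ?_) (h0 _ (by linarith))
  linarith [hmin i (Finset.mem_range.2 hi)]

variable [MeasurableSpace X]

/-- A rational between consecutive chain elements decouples them; each resulting condition concerns
the values of `H` at one point, so the convention for m = 1 and a countable union suffice. -/
theorem IsMeasurableClass.nullMeasurableSet_chainEnds {D : Measure (X × I)}
    [IsProbabilityMeasure D] (hH : IsMeasurableClass H D) (s : ℝ) (m : ℕ) {U : Set I}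
    (hU : IsOpen U) : NullMeasurableSet {x | (chainEnds H s x m ∩ U).Nonempty} D.fst := by
  have hbase : ∀ {U : Set I}, IsOpen U →
      NullMeasurableSet {x | ∃ u ∈ U, ∃ h ∈ H, h x = u} D.fst := by
    intro U hU
    have hmp := (measurePreserving_funUnique D.fst (Fin 1)).symm
    have h1 := (hH.2 1 {v | v 0 ∈ U} (hU.preimage (by fun_prop))).preimage
      hmp.quasiMeasurePreserving
    convert h1 using 1
    ext x
    constructor
    · rintro ⟨u, hu, h, hh, rfl⟩
      exact ⟨h, hh, hu⟩
    · rintro ⟨h, hh, hu⟩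
      exact ⟨h x, hu, h, hh, rfl⟩
  induction m generalizing U with
  | zero =>
    convert hbase hU using 1
    ext x
    constructor
    · rintro ⟨u, hu, huU⟩
      exact ⟨u, huU, hu⟩
    · rintro ⟨u, huU, hu⟩
      exact ⟨u, hu, huU⟩
  | succ m ih =>
    have hset : {x | (chainEnds H s x (m + 1) ∩ U).Nonempty}
        = ⋃ q : ℚ, {x | (chainEnds H s x m ∩ {w : I | (w : ℝ) < q}).Nonempty} ∩
            {x | ∃ u ∈ U ∩ {u : I | (q : ℝ) + s < u}, ∃ h ∈ H, h x = u} := by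
      ext x
      simp only [Set.mem_iUnion, Set.mem_inter_iff, Set.mem_ofPred_eq]
      constructor
      · rintro ⟨u, ⟨hu, w, hw, hlt⟩, huU⟩
        obtain ⟨q, hq1, hq2⟩ := exists_rat_btwn (show (w : ℝ) < u - s by linarith)
        exact ⟨q, ⟨w, hw, hq1⟩, u, ⟨huU, by linarith⟩, hu⟩
      · rintro ⟨q, ⟨w, hw, hq1⟩, u, ⟨huU, hq2⟩, hu⟩
        have hq1' : (w : ℝ) < q := hq1
        exact ⟨u, ⟨hu, w, hw, by linarith⟩, huU⟩
    rw [hset]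
    refine NullMeasurableSet.iUnion fun q => NullMeasurableSet.inter (ih ?_) (hbase ?_)
    · exact isOpen_lt (by fun_prop) continuous_const
    · exact hU.inter (isOpen_lt continuous_const (by fun_prop))

/-- If chains of values of `H` at every point have length at most `k`, a fixed list hypothesis
approximates all of `H`. -/
theorem exists_list_of_chainEnds_eq_empty {k : ℕ} (hk : 1 ≤ k) {s : ℝ} (hs : 0 ≤ s)
    (hempty : ∀ x, chainEnds H s x k = ∅) :
    ∃ μ : X → Fin k → I,
      (∀ D : Measure (X × I), IsProbabilityMeasure D → IsMeasurableClass H D →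
        AEMeasurable μ D.fst) ∧
      ∀ h ∈ H, ∀ x, ∃ j, |(μ x j : ℝ) - h x| ≤ s := by
  -- A greedy net whose entries are infima, so that sublevel sets are events about chains meeting an
  -- open set. The infimum of an empty set is 1, which is harmless.
  refine ⟨fun x j => sInf (chainEnds H s x j), fun D hD hH => ?_, fun h hh x => ?_⟩
  · refine aemeasurable_pi_iff.2 fun j => NullMeasurable.aemeasurable ?_
    have hm : @Measurable (NullMeasurableSpace X D.fst) I _ _
        fun x => sInf (chainEnds H s x j) := by
      refine measurable_of_Iio fun b => ?_
      have hset : (fun x : X => sInf (chainEnds H s x j)) ⁻¹' Set.Iio b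
          = {x | (chainEnds H s x j ∩ Set.Iio b).Nonempty} := by
        ext x
        simp only [Set.mem_preimage, Set.mem_Iio, sInf_lt_iff]
        rfl
      have hnull : NullMeasurableSet ((fun x : X => sInf (chainEnds H s x j)) ⁻¹' Set.Iio b)
          D.fst := by
        rw [hset]
        exact hH.nullMeasurableSet_chainEnds s j isOpen_Iio
      exact hnull
    exact fun t ht => hm ht
  · have h0 : sInf (chainEnds H s x 0) ≤ h x := sInf_le ⟨h, hh, rfl⟩
    -- Take the largest j whose infimum lies below h x. If h x exceeded it by more than s, then h x
    -- would end a longer chain, contradicting either maximality or the emptiness at level k.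
    set J := (Finset.range k).filter fun j => sInf (chainEnds H s x j) ≤ h x
    have hJ : J.Nonempty := ⟨0, Finset.mem_filter.2 ⟨Finset.mem_range.2 hk, h0⟩⟩
    have hmem := Finset.mem_filter.1 (J.max'_mem hJ)
    set j := J.max' hJ with hj
    have hjk := Finset.mem_range.1 hmem.1
    refine ⟨⟨j, hjk⟩, ?_⟩
    have hle : (sInf (chainEnds H s x j) : I) ≤ (h x : ℝ) := hmem.2
    have hge : (h x : ℝ) ≤ (sInf (chainEnds H s x j) : I) + s := by
      by_contra! hlt
      obtain ⟨w, hw, hws⟩ : ∃ w ∈ chainEnds H s x j, (w : ℝ) + s < h x := by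
        by_contra! hall
        have hb : (0 : ℝ) ≤ h x - s := by
          linarith [(sInf (chainEnds H s x j)).2.1]
        have hb1 : h x - s ≤ 1 := by linarith [(h x).2.2]
        have hle' : (⟨h x - s, hb, hb1⟩ : I) ≤ sInf (chainEnds H s x j) :=
          le_sInf fun w hw => Subtype.coe_le_coe.1 (by linarith [hall w hw] : (h x : ℝ) - s ≤ w)
        have : (h x : ℝ) - s ≤ (sInf (chainEnds H s x j) : I) := hle'
        linarith
      have hsucc : h x ∈ chainEnds H s x (j + 1) := ⟨⟨h, hh, rfl⟩, w, hw, hws⟩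
      rcases Nat.lt_or_ge (j + 1) k with hjk' | hjk'
      · have := J.le_max' (j + 1) (Finset.mem_filter.2
          ⟨Finset.mem_range.2 hjk', sInf_le hsucc⟩)
        omega
      · have : j + 1 = k := by omega
        rw [this, hempty x] at hsucc
        exact hsucc
    rw [abs_le]
    constructor <;> simp only <;> linarith

theorem listErr_le_iInf_add {k : ℕ} (hne : H.Nonempty) {D : Measure (X × I)}
    [IsProbabilityMeasure D] (hH : IsMeasurableClass H D) {μ : X → Fin k → I}
    (hμ : AEMeasurable μ D.fst) {s : ℝ} (hs : ∀ h ∈ H, ∀ x, ∃ j, |(μ x j : ℝ) - h x| ≤ s) :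
    listErr D μ ≤ (⨅ h : H, hypErr D h.1) + s := by
  have : Nonempty H := hne.to_subtype
  rw [← sub_le_iff_le_add]
  refine le_ciInf fun h => ?_
  have hm : AEMeasurable (fun x (_ : Fin 1) => h.1 x) D.fst :=
    aemeasurable_pi_iff.2 fun _ => hH.1 h.1 h.2
  rw [sub_le_iff_le_add]
  calc listErr D μ ≤ ∫ z, (listLoss (fun _ : Fin 1 => h.1 z.1) z.2 + s) ∂D := by
        refine integral_mono (integrable_listLoss hμ)
          ((integrable_listLoss hm).add (integrable_const s)) fun z => ?_
        obtain ⟨j, hj⟩ := hs h.1 h.2 z.1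
        exact listLoss_le_add hj z.2
    _ = hypErr D h.1 + s := by
        rw [integral_add (integrable_listLoss hm) (integrable_const s)]
        simp [hypErr, listErr]

end Deterministic

/-! ### Sample complexity and unknown accuracy -/

section Main

/-- A sample size of the order of `G` times a power of a logarithm dominates the logarithmic factor
at that sample size. -/
theorem mul_logFactor_pow_le {n k : ℕ} {G ε : ℝ} (hn : 1 ≤ n) (hk : 1 ≤ k) (hG : 1 ≤ G) (hε : 0 < ε)
    (hε1 : ε < 1) (h : 10 ^ 30 * G * (1 + Real.log ((1 + G) * k / ε)) ^ 4 ≤ n) :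
    256000000 * G * logFactor n k (ε / (10 ^ 30 * k)) ^ 4 ≤ n := by
  have hk' : (1 : ℝ) ≤ k := by exact_mod_cast hk
  have hn' : (1 : ℝ) ≤ n := by exact_mod_cast hn
  set u : ℝ := (1 + G) * k / ε with hu
  set y : ℝ := n / G with hy
  have hG0 : 0 < G := by linarith
  have hy0 : 0 < y := by positivity
  have hu1 : 1 ≤ u := by
    rw [hu, le_div_iff₀ hε]
    nlinarith
  have hlu := Real.log_nonneg hu1
  set ℓ := 1 + Real.log u with hℓ
  have hℓ1 : 1 ≤ ℓ := by linarith
  have hyℓ : 10 ^ 30 * ℓ ^ 4 ≤ y := by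
    rw [hy, le_div_iff₀ hG0]
    linarith
  have hyC : 10 ^ 30 ≤ y := by
    have : (1 : ℝ) ≤ ℓ ^ 4 := one_le_pow₀ hℓ1
    linarith
  have hΛ : logFactor n k (ε / (10 ^ 30 * k)) ≤ 2 * Real.log y + 2 * ℓ := by
    have h1 : (n : ℝ) * k / (ε / (10 ^ 30 * k)) ≤ y * (10 ^ 30 * u ^ 2) := by
      have e1 : (n : ℝ) * k / (ε / (10 ^ 30 * k)) = n * (10 ^ 30 * (k ^ 2 / ε)) := by
        field_simp
      have e2 : y * (10 ^ 30 * u ^ 2)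
          = n * (10 ^ 30 * ((1 + G) ^ 2 / G * (k ^ 2 / ε) * (1 / ε))) := by
        rw [hy, hu]; field_simp
      rw [e1, e2]
      have h2 : 1 ≤ (1 + G) ^ 2 / G := by
        rw [le_div_iff₀ hG0]; nlinarith
      have h3 : 1 ≤ 1 / ε := by rw [le_div_iff₀ hε]; linarith
      have h4 : (k : ℝ) ^ 2 / ε ≤ (1 + G) ^ 2 / G * (k ^ 2 / ε) * (1 / ε) := by
        have h5 : 0 ≤ (k : ℝ) ^ 2 / ε := by positivity
        calc (k : ℝ) ^ 2 / ε = 1 * (k ^ 2 / ε) * 1 := by ring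
          _ ≤ _ := by gcongr
      gcongr
    have h2 := Real.log_le_log (by positivity) h1
    rw [Real.log_mul (by positivity) (by positivity), Real.log_mul (by positivity) (by positivity),
      Real.log_pow u 2] at h2
    have h3 := Real.log_le_log (by positivity) hyC
    have h4 : Real.log (n * k / (ε / (10 ^ 30 * k))) ≤ Real.log y + (Real.log y + 2 * Real.log u) :=
      h2.trans (add_le_add le_rfl (add_le_add h3 le_rfl))
    unfold logFactor
    linarith
  have hΛ0 : 0 ≤ logFactor n k (ε / (10 ^ 30 * k)) := by
    unfold logFactor
    have : (1 : ℝ) ≤ n * k / (ε / (10 ^ 30 * k)) := by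
      rw [le_div_iff₀ (by positivity), one_mul, div_le_iff₀ (by positivity)]
      have h1 : (1 : ℝ) ≤ n * k := one_le_mul_of_one_le_of_one_le hn' hk'
      nlinarith
    linarith [Real.log_nonneg this]
  -- With the eighth root w of y, log y ≤ 8w, so (log y)^4 is of order √y and is absorbed by y ≥
  -- 10^30.
  obtain ⟨w, hw0, hw⟩ : ∃ w : ℝ, 0 < w ∧ w ^ 8 = y := by
    refine ⟨Real.sqrt (Real.sqrt (Real.sqrt y)), by positivity, ?_⟩
    rw [show (8 : ℕ) = 2 * 2 * 2 by norm_num, pow_mul, pow_mul, Real.sq_sqrt (by positivity),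
      Real.sq_sqrt (by positivity), Real.sq_sqrt hy0.le]
  have hw4 : 10 ^ 15 ≤ w ^ 4 := by
    have : ((10 : ℝ) ^ 15) ^ 2 ≤ (w ^ 4) ^ 2 := by
      rw [← pow_mul, ← pow_mul, hw]
      simpa using hyC
    exact le_of_sq_le_sq this (by positivity)
  have hly : Real.log y ≤ 8 * w := by
    rw [← hw, Real.log_pow]
    have := Real.log_le_sub_one_of_pos hw0
    push_cast
    linarith
  have hly0 : 0 ≤ Real.log y := Real.log_nonneg (by linarith)
  have h4 : logFactor n k (ε / (10 ^ 30 * k)) ^ 4 ≤ 128 * (4096 * w ^ 4) + 128 * ℓ ^ 4 := by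
    have h5 : logFactor n k (ε / (10 ^ 30 * k)) ≤ 16 * w + 2 * ℓ := by linarith
    calc _ ≤ (16 * w + 2 * ℓ) ^ 4 := pow_le_pow_left₀ hΛ0 h5 4
      _ ≤ 2 ^ 3 * ((16 * w) ^ 4 + (2 * ℓ) ^ 4) := by
        have := add_pow_le (by positivity : (0 : ℝ) ≤ 16 * w) (by positivity : (0 : ℝ) ≤ 2 * ℓ) 4
        simpa using this
      _ = _ := by ring
  have h6 : 256000000 * (128 * (4096 * w ^ 4) + 128 * ℓ ^ 4) ≤ y := by
    have h7 : 10 ^ 15 * w ^ 4 ≤ y := by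
      calc 10 ^ 15 * w ^ 4 ≤ w ^ 4 * w ^ 4 := by gcongr
        _ = y := by rw [← hw]; ring
    have h8 : 0 < w ^ 4 := by positivity
    have h9 : 0 < ℓ ^ 4 := by positivity
    linarith
  calc 256000000 * G * logFactor n k (ε / (10 ^ 30 * k)) ^ 4
      ≤ G * (256000000 * (128 * (4096 * w ^ 4) + 128 * ℓ ^ 4)) := by nlinarith
    _ ≤ G * y := by gcongr
    _ = n := by rw [hy]; field_simp

variable {X : Type*} {H : Set (X → I)}

theorem fatDim_eq_zero {γ : ℝ} {k : ℕ} (hfin : fatDim H γ k ≠ ⊤) (h : (fatDim H γ k).toNat = 0) :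
    fatDim H γ k = 0 := by
  rw [← ENat.natCast_toNat hfin, h]
  rfl

theorem log_one_div_pos {δ : ℝ} (hδ : 0 < δ) (hδ1 : δ < 1) : 0 < Real.log (1 / δ) :=
  Real.log_pos (by rw [lt_div_iff₀ hδ]; linarith)

/-- A sample size sufficient for accuracy `ε`, up to the contribution of the confidence. -/
def Feasible (H : Set (X → I)) (k n : ℕ) (ε : ℝ) : Prop :=
  0 < ε ∧ ε < 1 ∧ fatDim H (ε / (10 ^ 30 * k) / 2) k ≠ ⊤ ∧
    10 ^ 30 * ((k : ℝ) ^ 8 * (fatDim H (ε / (10 ^ 30 * k) / 2) k).toNat / ε ^ 2) *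
      (1 + Real.log ((1 + (k : ℝ) ^ 8 * (fatDim H (ε / (10 ^ 30 * k) / 2) k).toNat / ε ^ 2)
        * k / ε)) ^ 4 ≤ n

theorem one_le_log_term {G ε : ℝ} {k : ℕ} (hk : 1 ≤ k) (hG : 0 ≤ G) (hε : 0 < ε) (hε1 : ε < 1) :
    1 ≤ 1 + Real.log ((1 + G) * k / ε) := by
  have hk' : (1 : ℝ) ≤ k := by exact_mod_cast hk
  have : 1 ≤ (1 + G) * k / ε := by
    rw [le_div_iff₀ hε]
    nlinarith
  linarith [Real.log_nonneg this]

theorem Feasible.le {k n : ℕ} (hk : 1 ≤ k) {ε : ℝ} (h : Feasible H k n ε) :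
    10 ^ 30 * ((k : ℝ) ^ 8 * (fatDim H (ε / (10 ^ 30 * k) / 2) k).toNat / ε ^ 2) ≤ n := by
  obtain ⟨hε, hε1, -, hle⟩ := h
  refine le_trans ?_ hle
  exact le_mul_of_one_le_right (by positivity)
    (one_le_pow₀ (one_le_log_term hk (by positivity) hε hε1))

/-- If arbitrarily small accuracies are feasible, all dimensions vanish. -/
theorem fatDim_eq_zero_of_feasible {k n : ℕ} (hk : 1 ≤ k)
    (h : ∀ η : ℝ, 0 < η → ∃ ε < η, Feasible H k n ε) {γ : ℝ} (hγ : 0 < γ) :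
    fatDim H γ k = 0 := by
  have hk' : (1 : ℝ) ≤ k := by exact_mod_cast hk
  -- For ε below 1/(n+1), a dimension at least 1 would make the required sample size exceed n.
  obtain ⟨ε, hεη, hF⟩ := h (min γ (1 / (n + 1))) (by positivity)
  have hε := hF.1
  have h1 : ε < γ := hεη.trans_le (min_le_left _ _)
  have h2 : ε < 1 / (n + 1) := hεη.trans_le (min_le_right _ _)
  have hle := hF.le hk
  have h0 : (fatDim H (ε / (10 ^ 30 * k) / 2) k).toNat = 0 := by
    by_contra hne
    have hd : (1 : ℝ) ≤ (fatDim H (ε / (10 ^ 30 * k) / 2) k).toNat := by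
      exact_mod_cast Nat.one_le_iff_ne_zero.2 hne
    have hkd : (1 : ℝ) ≤ (k : ℝ) ^ 8 * (fatDim H (ε / (10 ^ 30 * k) / 2) k).toNat :=
      one_le_mul_of_one_le_of_one_le (one_le_pow₀ hk') hd
    have h3 : (n + 1 : ℝ) < 1 / ε := by
      rw [lt_div_iff₀ hε]
      rw [lt_div_iff₀ (by positivity)] at h2
      linarith
    have h4 : 1 / ε ≤ (k : ℝ) ^ 8 * (fatDim H (ε / (10 ^ 30 * k) / 2) k).toNat / ε ^ 2 := by
      rw [div_le_div_iff₀ hε (by positivity)]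
      nlinarith [hF.2.1, mul_pos hε hε]
    have h5 : (0 : ℝ) ≤ n := Nat.cast_nonneg _
    linarith
  have hscale : ε / (10 ^ 30 * k) / 2 ≤ γ := by
    rw [div_div, div_le_iff₀ (by positivity)]
    nlinarith
  have := fatDim_anti (H := H) hscale k
  rw [fatDim_eq_zero hF.2.2.1 h0] at this
  exact nonpos_iff_eq_zero.1 this

/-- The confidence is split off so that the scale can be selected without knowing δ. -/
theorem Feasible.of_complexity {k n : ℕ} (hk : 1 ≤ k) {ε δ : ℝ} (hε : 0 < ε) (hε1 : ε < 1)
    (hδ : 0 < δ) (hδ1 : δ < 1) (hfin : fatDim H (ε / (10 ^ 30 * k) / 2) k ≠ ⊤)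
    (h : 10 ^ 30 * (complexity H k (ε / (10 ^ 30 * k)) δ / ε ^ 2) *
      (1 + Real.log ((1 + complexity H k (ε / (10 ^ 30 * k)) δ / ε ^ 2) * k / ε)) ^ 4 ≤ n) :
    Feasible H k n ε ∧ 10 ^ 30 * (Real.log (1 / δ) / ε ^ 2) ≤ n := by
  have hk' : (1 : ℝ) ≤ k := by exact_mod_cast hk
  have hlδ := log_one_div_pos hδ hδ1
  set G₀ := (k : ℝ) ^ 8 * (fatDim H (ε / (10 ^ 30 * k) / 2) k).toNat / ε ^ 2 with hG₀
  set G := complexity H k (ε / (10 ^ 30 * k)) δ / ε ^ 2 with hG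
  have hsum : G = G₀ + Real.log (1 / δ) / ε ^ 2 := by
    rw [hG, hG₀, complexity, add_div]
  have hG₀0 : 0 ≤ G₀ := by positivity
  have hl0 : 0 ≤ Real.log (1 / δ) / ε ^ 2 := by positivity
  have hGG : G₀ ≤ G := by linarith
  have hG0 : 0 ≤ G := hG₀0.trans hGG
  have h1 := one_le_log_term hk hG₀0 hε hε1
  have h2 : 1 + Real.log ((1 + G₀) * k / ε) ≤ 1 + Real.log ((1 + G) * k / ε) := by
    gcongr
  constructor
  · refine ⟨hε, hε1, hfin, le_trans ?_ h⟩
    rw [← hG₀]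
    gcongr
  · refine le_trans ?_ h
    have h3 : 1 ≤ (1 + Real.log ((1 + G) * k / ε)) ^ 4 := one_le_pow₀ (h1.trans h2)
    calc 10 ^ 30 * (Real.log (1 / δ) / ε ^ 2) ≤ 10 ^ 30 * G := by linarith
      _ ≤ _ := le_mul_of_one_le_right (by linarith) h3

variable [MeasurableSpace X]

/-- The failure event of a list hypothesis with excess error `r` for a learner `a` that sees
samples of a fixed size. -/
def failure (H : Set (X → I)) {n k : ℕ} (a : (Fin n → X × I) → X → Fin k → I)
    (D : Measure (X × I)) (r : ℝ) : Set (Fin n → X × I) :=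
  {S | ¬ (AEMeasurable (a S) D.fst ∧ listErr D (a S) ≤ (⨅ h : H, hypErr D h.1) + r)}

theorem failure_anti {n k : ℕ} (a : (Fin n → X × I) → X → Fin k → I)
    (D : Measure (X × I)) {r r' : ℝ} (h : r ≤ r') : failure H a D r' ⊆ failure H a D r :=
  fun _ hS hgood => hS ⟨hgood.1, by linarith [hgood.2]⟩

/-- If chains at all points are short, a constant learner never fails. -/
theorem exists_constant_learner {k : ℕ} (hne : H.Nonempty) (hk : 1 ≤ k) {s : ℝ} (hs : 0 ≤ s)
    (hempty : ∀ x, chainEnds H s x k = ∅) :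
    ∃ μ : X → Fin k → I, ∀ D : Measure (X × I), IsProbabilityMeasure D → IsMeasurableClass H D →
      ∀ (n : ℕ) (r : ℝ), s ≤ r → failure H (fun _ : Fin n → X × I => μ) D r = ∅ := by
  obtain ⟨μ, hμ, hclose⟩ := exists_list_of_chainEnds_eq_empty hk hs hempty
  refine ⟨μ, fun D hD hH n r hr => ?_⟩
  rw [Set.eq_empty_iff_forall_notMem]
  intro S hS
  exact hS ⟨hμ D hD hH, by
    linarith [listErr_le_iInf_add hne hH (hμ D hD hH) hclose]⟩

theorem one_le_logFactor {n k : ℕ} {γ : ℝ} (hn : 1 ≤ n) (hk : 1 ≤ k) (hγ : 0 < γ) (hγ1 : γ < 1) :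
    1 ≤ logFactor n k γ := by
  have hk' : (1 : ℝ) ≤ k := by exact_mod_cast hk
  have hn' : (1 : ℝ) ≤ n := by exact_mod_cast hn
  have h1 : (1 : ℝ) ≤ n * k := one_le_mul_of_one_le_of_one_le hn' hk'
  have : 1 ≤ (n * k : ℝ) / γ := by
    rw [le_div_iff₀ hγ]
    linarith
  unfold logFactor
  linarith [Real.log_nonneg this]

/-- The bound for a known scale, for a fixed sample size. -/
theorem exists_learner_known_scale {γ : ℝ} {n k : ℕ} (hne : H.Nonempty) (hγ : 0 < γ) (hγ1 : γ < 1)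
    (hk : 1 ≤ k) (hn : 1 ≤ n) (hfin : fatDim H (γ / 2) k ≠ ⊤) :
    ∃ a : (Fin n → X × I) → X → Fin k → I, ∀ D : Measure (X × I), IsProbabilityMeasure D →
      IsMeasurableClass H D → ∀ δ : ℝ, 0 < δ → δ < 1 →
        (Measure.pi fun _ : Fin n => D) (failure H a D (10 ^ 30 * k * γ +
          10 ^ 30 * Real.sqrt (complexity H k γ δ / n) * logFactor n k γ ^ 4))
        ≤ ENNReal.ofReal δ := by
  have hk' : (1 : ℝ) ≤ k := by exact_mod_cast hk
  have hn0 : (0 : ℝ) < n := by exact_mod_cast hn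
  have hΛ := one_le_logFactor hn hk hγ hγ1
  have hkγ : γ ≤ k * γ := by nlinarith
  -- In dimension zero the complexity is log(1/δ) alone, which may be arbitrarily small, so only a
  -- learner without failures will do.
  rcases Nat.eq_zero_or_pos (fatDim H (γ / 2) k).toNat with h0 | hd
  · obtain ⟨μ, hμ⟩ := exists_constant_learner hne hk (s := 2 * (γ / 2)) (by linarith)
      (chainEnds_eq_empty (by linarith) (fatDim_eq_zero hfin h0))
    refine ⟨fun _ => μ, fun D hD hH δ hδ hδ1 => ?_⟩
    rw [hμ D hD hH n _ ?_]
    · simp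
    · have : 0 ≤ 10 ^ 30 * Real.sqrt (complexity H k γ δ / n) * logFactor n k γ ^ 4 := by positivity
      linarith
  · obtain ⟨a, ha⟩ := exists_learner_at_scale (X := X) hne hγ hγ1 hk hn hfin hd
    refine ⟨a, fun D hD hH δ hδ hδ1 => ?_⟩
    refine (measure_mono (failure_anti a D ?_)).trans (ha D hD hH δ hδ hδ1)
    have hlδ := log_one_div_pos hδ hδ1
    have h1 : Real.sqrt (((k : ℝ) ^ 8 * (fatDim H (γ / 2) k).toNat * logFactor n k γ ^ 4
        + Real.log (1 / δ)) / n)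
        ≤ Real.sqrt (complexity H k γ δ / n) * logFactor n k γ ^ 4 := by
      have hΛ2 : logFactor n k γ ^ 2 ≤ logFactor n k γ ^ 4 :=
        pow_le_pow_right₀ hΛ (by norm_num)
      have hΛ4 : 1 ≤ logFactor n k γ ^ 4 := one_le_pow₀ hΛ
      calc _ ≤ Real.sqrt (complexity H k γ δ / n * (logFactor n k γ ^ 2) ^ 2) := by
            apply Real.sqrt_le_sqrt
            rw [← pow_mul, div_mul_eq_mul_div]
            gcongr
            unfold complexity
            nlinarith
        _ = Real.sqrt (complexity H k γ δ / n) * logFactor n k γ ^ 2 := by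
            rw [Real.sqrt_mul' _ (by positivity), Real.sqrt_sq (by positivity)]
        _ ≤ _ := by gcongr
    have h2 : 0 ≤ Real.sqrt (complexity H k γ δ / n) * logFactor n k γ ^ 4 := by positivity
    linarith

/-- A learner for samples of size `n` that attains every feasible accuracy. -/
theorem exists_learner_unknown_scale {k : ℕ} (hne : H.Nonempty) (hk : 1 ≤ k) (n : ℕ) :
    ∃ a : (Fin n → X × I) → X → Fin k → I, ∀ ε δ : ℝ, Feasible H k n ε → 0 < δ → δ < 1 →
      10 ^ 30 * (Real.log (1 / δ) / ε ^ 2) ≤ n →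
      ∀ D : Measure (X × I), IsProbabilityMeasure D → IsMeasurableClass H D →
        (Measure.pi fun _ : Fin n => D) (failure H a D ε) ≤ ENNReal.ofReal δ := by
  have hk' : (1 : ℝ) ≤ k := by exact_mod_cast hk
  by_cases hsmall : ∀ η : ℝ, 0 < η → ∃ ε < η, Feasible H k n ε
  · obtain ⟨μ, hμ⟩ := exists_constant_learner hne hk le_rfl
      (chainEnds_zero_eq_empty hk fun γ hγ => fatDim_eq_zero_of_feasible hk hsmall hγ)
    refine ⟨fun _ => μ, fun ε δ hF _ _ _ D hD hH => ?_⟩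
    rw [hμ D hD hH n ε hF.1.le]
    simp
  push Not at hsmall
  obtain ⟨η, hη, hηF⟩ := hsmall
  by_cases hex : ∃ ε, Feasible H k n ε
  swap
  · exact ⟨fun _ _ _ => 0, fun ε _ hF => absurd ⟨ε, hF⟩ hex⟩
  -- The infimum of feasible accuracies need not be attained; a factor 2 is given up.
  obtain ⟨ε₁, hF₁, hmin⟩ : ∃ ε₁, Feasible H k n ε₁ ∧ ∀ ε, Feasible H k n ε → ε₁ ≤ 2 * ε := by
    have hbdd : BddBelow {ε | Feasible H k n ε} := ⟨η, fun ε hε => by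
      by_contra! hlt
      exact hηF ε hlt hε⟩
    have hpos : 0 < sInf {ε | Feasible H k n ε} :=
      hη.trans_le (le_csInf hex fun ε hε => by
        by_contra! hlt
        exact hηF ε hlt hε)
    obtain ⟨ε₁, hF₁, hlt⟩ := exists_lt_of_csInf_lt hex
      (show sInf {ε | Feasible H k n ε} < 2 * sInf {ε | Feasible H k n ε} by linarith)
    exact ⟨ε₁, hF₁, fun ε hε => by linarith [csInf_le hbdd hε]⟩
  obtain ⟨hε₁, hε₁1, hfin, hle⟩ := hF₁
  set γ := ε₁ / (10 ^ 30 * k) with hγ_def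
  have hγ : 0 < γ := by positivity
  have hγε : 10 ^ 30 * γ ≤ ε₁ := by
    rw [hγ_def, ← mul_div_assoc, div_le_iff₀ (by positivity)]
    nlinarith
  rcases Nat.eq_zero_or_pos (fatDim H (γ / 2) k).toNat with h0 | hd
  · obtain ⟨μ, hμ⟩ := exists_constant_learner hne hk (s := 2 * (γ / 2)) (by linarith)
      (chainEnds_eq_empty (by linarith) (fatDim_eq_zero hfin h0))
    refine ⟨fun _ => μ, fun ε δ hF _ _ _ D hD hH => ?_⟩
    rw [hμ D hD hH n ε (by linarith [hmin ε hF])]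
    simp
  have hd' : (1 : ℝ) ≤ (fatDim H (γ / 2) k).toNat := by exact_mod_cast hd
  set G := (k : ℝ) ^ 8 * (fatDim H (γ / 2) k).toNat / ε₁ ^ 2 with hG
  have hG1 : 1 ≤ G := by
    rw [hG, le_div_iff₀ (by positivity), one_mul]
    have h1 : (1 : ℝ) ≤ (k : ℝ) ^ 8 * (fatDim H (γ / 2) k).toNat :=
      one_le_mul_of_one_le_of_one_le (one_le_pow₀ hk') hd'
    have h2 : ε₁ ^ 2 ≤ 1 := pow_le_one₀ hε₁.le hε₁1.le
    linarith
  have hn0 : (0 : ℝ) < n := by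
    have : 10 ^ 30 * G ≤ n := Feasible.le (n := n) hk ⟨hε₁, hε₁1, hfin, hle⟩
    linarith
  have hn : 1 ≤ n := by exact_mod_cast hn0
  have hkey := mul_logFactor_pow_le hn hk hG1 hε₁ hε₁1 hle
  rw [← hγ_def] at hkey
  obtain ⟨a, ha⟩ := exists_learner_at_scale (X := X) hne hγ (by linarith) hk hn hfin hd
  refine ⟨a, fun ε δ hF hδ hδ1 hlog D hD hH => ?_⟩
  refine (measure_mono (failure_anti a D ?_)).trans (ha D hD hH δ hδ hδ1)
  have hε₁ε := hmin ε hF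
  have hε := hF.1
  have hlδ := log_one_div_pos hδ hδ1
  have hrad : Real.sqrt (((k : ℝ) ^ 8 * (fatDim H (γ / 2) k).toNat * logFactor n k γ ^ 4
      + Real.log (1 / δ)) / n) ≤ ε / 4000 := by
    rw [Real.sqrt_le_left (by positivity), div_le_iff₀ hn0]
    -- Here 256000000 = 16 · 4000²: after ε₁ ≤ 2ε this term uses only a quarter of the allowed
    -- (ε/4000)².
    have h1 : 256000000 * ((k : ℝ) ^ 8 * (fatDim H (γ / 2) k).toNat * logFactor n k γ ^ 4)
        ≤ n * ε₁ ^ 2 := by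
      have e : 256000000 * ((k : ℝ) ^ 8 * (fatDim H (γ / 2) k).toNat * logFactor n k γ ^ 4)
          = 256000000 * G * logFactor n k γ ^ 4 * ε₁ ^ 2 := by
        rw [hG]; field_simp
      rw [e]
      gcongr
    have h2 : n * ε₁ ^ 2 ≤ n * (2 * ε) ^ 2 := by gcongr
    have h3 : 10 ^ 30 * Real.log (1 / δ) ≤ n * ε ^ 2 := by
      rw [← mul_div_assoc, div_le_iff₀ (by positivity)] at hlog
      exact hlog
    nlinarith
  linarith

end Main

end ListRegression

end

/-! ### The theorem -/

open ListRegression in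
theorem mainTheorem1 :
    ∃ C : ℝ, 1 ≤ C ∧ ∃ p : ℕ,
      ∀ (X : Type*) [MeasurableSpace X] (H : Set (X → I)) (k : ℕ), H.Nonempty → 1 ≤ k →
        (∀ γ : ℝ, 0 < γ → γ < 1 → fatDim H (γ / 2) k ≠ ⊤ →
          ∃ A : ListLearner X k,
            ∀ D : Measure (X × I), IsProbabilityMeasure D → IsMeasurableClass H D →
              ∀ (n : ℕ) (δ : ℝ), 1 ≤ n → 0 < δ → δ < 1 →
                AgnosticBound H A D n
                  (C * k * γ +
                    C * Real.sqrt (complexity H k γ δ / n) *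
                      (1 + Real.log (n * k / γ)) ^ p) δ) ∧
        (∃ A : ListLearner X k,
          ∀ ε δ γ : ℝ, 0 < ε → ε < 1 → 0 < δ → δ < 1 → γ = ε / (C * k) →
            fatDim H (γ / 2) k ≠ ⊤ →
              sampleComplexity H A ε δ ≤
                (⌈C * (complexity H k γ δ / ε ^ 2) *
                  (1 + Real.log ((1 + complexity H k γ δ / ε ^ 2) * k / ε)) ^ p⌉₊ : ℕ∞)) := by
  refine ⟨10 ^ 30, by norm_num, 4, fun X _ H k hne hk => ⟨fun γ hγ hγ1 hfin => ?_, ?_⟩⟩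
  · choose! a ha using fun (n : ℕ) (hn : 1 ≤ n) =>
      exists_learner_known_scale (X := X) (n := n) hne hγ hγ1 hk hn hfin
    exact ⟨a, fun D hD hH n δ hn hδ hδ1 => ha n hn D hD hH δ hδ hδ1⟩
  · choose a ha using fun n : ℕ => exists_learner_unknown_scale (X := X) hne hk n
    refine ⟨a, fun ε δ γ hε hε1 hδ hδ1 hγ hfin => ?_⟩
    subst hγ
    refine iInf₂_le_of_le _ (fun n hn D hD hH => ?_) le_rfl
    obtain ⟨hF, hlog⟩ := Feasible.of_complexity hk hε hε1 hδ hδ1 hfin (Nat.ceil_le.1 hn)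
    exact ha n ε δ hF hδ hδ1 hlog D hD hH
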